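/- Let $N$ be an SQ-Sasakian manifold of dimension $2n+1$: a Riemannian manifold $(N,g)$ with Levi-Civita connection $\bar\nabla$ and an almost contact metric structure $(\phi,\xi,\eta,g)$ which is normal, whose fundamental 2-form $\Phi(X,Y)=g(X,\phi Y)$ is closed, and for which $\bar\nabla_X\xi=-\beta\,\phi X$ for a smooth function $\beta$ with $\xi\beta=0$. Let $\widetilde{\bar\nabla}$ be its semisymmetric metric connection, i.e. the connection with $\widetilde{\bar\nabla}g=0$ and torsion $\tau(X,Y)=\eta(Y)X-\eta(X)Y$. Let $M$ be a non-empty (immersed) submanifold of $N$ of dimension $2m+1$, $m<n$, with the induced metric $g$, which is anti-invariant (for every $X$ tangent to $M$, $\phi X$ is normal to $M$) and such that $\xi$ is tangent to $M$. Let $S$ be the Ricci tensor of the Levi-Civita connection of $M$, let $\widetilde\nabla$ be the connection induced on $M$ by $\widetilde{\bar\nabla}$ (its tangential part), and let $\widetilde S$ be the Ricci tensor of $\widetilde\nabla$, where the Ricci tensor of a connection with curvature $R$ is $(Y,Z)\mapsto\operatorname{trace}(X\mapsto R(X,Y)Z)$ with $R(X,Y)Z=\nabla_X\nabla_YZ-\nabla_Y\nabla_XZ-\nabla_{[X,Y]}Z$.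 Suppose that $(g,\xi,\lambda)$, $\lambda\in\mathbb R$, is a Ricci soliton on $M$ with respect to the semisymmetric metric connection, i.e. for all $Y,Z$ tangent to $M$ $$g(\widetilde\nabla_Y\xi,Z)+g(Y,\widetilde\nabla_Z\xi)+2\widetilde S(Y,Z)+2\lambda g(Y,Z)=0 .$$ Then for all $Y,Z$ tangent to $M$ $$S(Y,Z)=(2m-2-\lambda)\,g(Y,Z)-(2m-2)\,\eta(Y)\eta(Z)+(2m-1)\,\Phi(Y,Z),$$ and, if $m\ge 2$, $M$ is pseudo $\eta$-Einstein: $S$ is not identically zero, and $S=p\,g+q\,\eta\otimes\eta+s\,D$ for smooth functions $p,q,s$ on $M$, with $q$ and $s$ nowhere zero, and a smooth $(0,2)$-tensor $D$ on $M$ with $D(X,\xi)=0$ for every $X$. -/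

import Mathlib

open Bundle Manifold
open scoped Manifold ContDiff Topology

noncomputable section

/-! ### Affine connections: curvature, Ricci tensor, special connections -/

section Connections

variable {E : Type*} [NormedAddCommGroup E] [NormedSpace ℝ E]
  {H : Type*} [TopologicalSpace H] {I : ModelWithCorners ℝ E H}
  {M : Type*} [TopologicalSpace M] [ChartedSpace H M] [IsManifold I ∞ M]

/-- The curvature `R(X, Y)Z = ∇_X ∇_Y Z - ∇_Y ∇_X Z - ∇_{[X, Y]} Z` of an affine connection.
Recall that `cov Z x (X x)` is `(∇_X Z)(x)`. -/
def curvature (cov : CovariantDerivative I E (TangentSpace I : M → Type _))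
    (X Y Z : Π x : M, TangentSpace I x) (x : M) : TangentSpace I x :=
  cov (fun p ↦ cov Z p (Y p)) x (X x) - cov (fun p ↦ cov Z p (X p)) x (Y x)
    - cov Z x (VectorField.mlieBracket I X Y x)

/-- The curvature at a point, on tangent vectors. They are extended to vector fields which are
smooth near the point; for a smooth connection the value does not depend on the extensions. -/
def curvatureAt (cov : CovariantDerivative I E (TangentSpace I : M → Type _))
    (x : M) (u v w : TangentSpace I x) : TangentSpace I x :=
  curvature cov (FiberBundle.extend E u) (FiberBundle.extend E v) (FiberBundle.extend E w) x

/-- The Ricci tensor `S(v, w)` of an affine connection: the trace of `u ↦ R(u, v)w`, computed in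
a basis of the tangent space. -/
def ricci [FiniteDimensional ℝ E]
    (cov : CovariantDerivative I E (TangentSpace I : M → Type _))
    (x : M) (v w : TangentSpace I x) : ℝ :=
  letI b : Module.Basis (Fin (Module.finrank ℝ E)) ℝ (TangentSpace I x) := Module.finBasis ℝ E
  ∑ i, b.coord i (curvatureAt cov x (b i) v w)

variable [FiniteDimensional ℝ E] [RiemannianBundle (fun x : M ↦ TangentSpace I x)]

/-- The connection is metric: `X g(Y, Z) = g(∇_X Y, Z) + g(Y, ∇_X Z)`, that is, `∇g = 0`. -/
def IsMetricConnection (cov : CovariantDerivative I E (TangentSpace I : M → Type _)) : Prop :=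
  ∀ (x : M) (Y Z : Π x : M, TangentSpace I x), MDiffAt (T% Y) x → MDiffAt (T% Z) x →
    ∀ v : TangentSpace I x,
      mvfderiv I (fun p ↦ (inner ℝ (Y p) (Z p) : ℝ)) x v
        = inner ℝ (cov Y x v) (Z x) + inner ℝ (Y x) (cov Z x v)

/-- The Levi-Civita connection: the metric connection without torsion. -/
structure IsLeviCivita (cov : CovariantDerivative I E (TangentSpace I : M → Type _)) : Prop where
  metric : IsMetricConnection cov
  torsion_eq_zero : cov.torsion = 0

/-- The semisymmetric metric connection of a one-form `η`: the metric connection whose torsion is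
`τ(X, Y) = η(Y)X - η(X)Y`. -/
structure IsSemisymmetricMetric (η : Π x : M, TangentSpace I x →L[ℝ] ℝ)
    (cov : CovariantDerivative I E (TangentSpace I : M → Type _)) : Prop where
  metric : IsMetricConnection cov
  torsion_eq : ∀ (x : M) (u v : TangentSpace I x), cov.torsion x u v = η x v • u - η x u • v

/-- `(g, V, lam)` is a Ricci soliton with respect to the connection `∇ = cov`:
`(£_V g)(Y, Z) + 2 S(Y, Z) + 2 lam g(Y, Z) = 0`, where `S` is the Ricci tensor of `∇` and
`(£_V g)(Y, Z) = g(∇_Y V, Z) + g(Y, ∇_Z V)`. -/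
def IsRicciSolitonWrt (cov : CovariantDerivative I E (TangentSpace I : M → Type _))
    (V : Π x : M, TangentSpace I x) (lam : ℝ) : Prop :=
  ∀ (x : M) (y z : TangentSpace I x),
    (inner ℝ (cov V x y) z + inner ℝ y (cov V x z)) + 2 * ricci cov x y z
      + 2 * lam * inner ℝ y z = 0

/-- Pseudo `η`-Einstein manifolds with Ricci tensor `S`: `S` is not identically zero and
`S(Y, Z) = p g(Y, Z) + q η(Y) η(Z) + s D(Y, Z)`, where `p, q, s` are scalars with `q ≠ 0`,
`s ≠ 0`, and `D` is a `(0,2)`-tensor with `D(Y, ξ) = 0` for all `Y`. -/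
def IsPseudoEtaEinstein (S : Π x : M, TangentSpace I x → TangentSpace I x → ℝ)
    (ξ : Π x : M, TangentSpace I x) (η : Π x : M, TangentSpace I x →L[ℝ] ℝ) : Prop :=
  (∃ (x : M) (y z : TangentSpace I x), S x y z ≠ 0) ∧
  ∃ (p q s : M → ℝ) (D : Π x : M, TangentSpace I x →L[ℝ] TangentSpace I x →L[ℝ] ℝ),
    ContMDiff I 𝓘(ℝ) ∞ p ∧ ContMDiff I 𝓘(ℝ) ∞ q ∧ ContMDiff I 𝓘(ℝ) ∞ s ∧
    ContMDiff I (I.prod 𝓘(ℝ, E →L[ℝ] E →L[ℝ] ℝ)) ∞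
      (fun x ↦ TotalSpace.mk' (E →L[ℝ] E →L[ℝ] ℝ)
        (E := fun x ↦ TangentSpace I x →L[ℝ] TangentSpace I x →L[ℝ] ℝ) x (D x)) ∧
    (∀ x, q x ≠ 0) ∧ (∀ x, s x ≠ 0) ∧ (∀ x y, D x y (ξ x) = 0) ∧
    ∀ (x : M) (y z : TangentSpace I x),
      S x y z = p x * inner ℝ y z + q x * (η x y * η x z) + s x * D x y z

end Connections

/-! ### Almost contact metric structures and SQ-Sasakian structures -/

section Contact

variable {E : Type*} [NormedAddCommGroup E] [NormedSpace ℝ E]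
  {H : Type*} [TopologicalSpace H] (I : ModelWithCorners ℝ E H)
  (N : Type*) [TopologicalSpace N] [ChartedSpace H N] [IsManifold I ∞ N]
  [RiemannianBundle (fun x : N ↦ TangentSpace I x)]

/-- An almost contact metric structure `(φ, ξ, η, g)` on a Riemannian manifold `(N, g)`. -/
structure AlmostContactMetric where
  /-- the `(1,1)`-tensor field `φ` -/
  φ : Π x : N, TangentSpace I x →L[ℝ] TangentSpace I x
  /-- the structure vector field `ξ` -/
  ξ : Π x : N, TangentSpace I x
  /-- the one-form `η` -/
  η : Π x : N, TangentSpace I x →L[ℝ] ℝ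
  contMDiff_φ : ContMDiff I (I.prod 𝓘(ℝ, E →L[ℝ] E)) ∞
    (fun x ↦ TotalSpace.mk' (E →L[ℝ] E)
      (E := fun x ↦ TangentSpace I x →L[ℝ] TangentSpace I x) x (φ x))
  contMDiff_ξ : ContMDiff I (I.prod 𝓘(ℝ, E)) ∞
    (fun x ↦ TotalSpace.mk' E (E := fun x ↦ TangentSpace I x) x (ξ x))
  contMDiff_η : ContMDiff I (I.prod 𝓘(ℝ, E →L[ℝ] ℝ)) ∞
    (fun x ↦ TotalSpace.mk' (E →L[ℝ] ℝ)
      (E := fun x ↦ TangentSpace I x →L[ℝ] ℝ) x (η x))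
  φ_φ : ∀ x (u : TangentSpace I x), φ x (φ x u) = -u + η x u • ξ x
  φ_ξ : ∀ x, φ x (ξ x) = 0
  η_ξ : ∀ x, η x (ξ x) = 1
  inner_ξ : ∀ x (u : TangentSpace I x), inner ℝ u (ξ x) = η x u
  η_φ : ∀ x (u : TangentSpace I x), η x (φ x u) = 0
  inner_φ_φ : ∀ x (u v : TangentSpace I x),
    inner ℝ (φ x u) (φ x v) = inner ℝ u v - η x u * η x v
  inner_φ_left : ∀ x (u v : TangentSpace I x), inner ℝ (φ x u) v = -inner ℝ u (φ x v)

variable {I N}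

namespace AlmostContactMetric

/-- The fundamental two-form `Φ(u, v) = g(u, φ v)`. -/
def fundamentalForm (A : AlmostContactMetric I N) (x : N) (u v : TangentSpace I x) : ℝ :=
  inner ℝ u (A.φ x v)

/-- The exterior derivative of `η`,
`dη(X, Y) = (X(η(Y)) - Y(η(X)) - η([X, Y])) / 2`. -/
def dη (A : AlmostContactMetric I N) (X Y : Π x : N, TangentSpace I x) (x : N) : ℝ :=
  (mvfderiv I (fun p ↦ A.η p (Y p)) x (X x) - mvfderiv I (fun p ↦ A.η p (X p)) x (Y x)
    - A.η x (VectorField.mlieBracket I X Y x)) / 2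

/-- The exterior derivative of the fundamental two-form,
`3 dΦ(X, Y, Z) = X Φ(Y, Z) + Y Φ(Z, X) + Z Φ(X, Y) - Φ([X, Y], Z) - Φ([Y, Z], X) - Φ([Z, X], Y)`.
-/
def dΦ (A : AlmostContactMetric I N) (X Y Z : Π x : N, TangentSpace I x) (x : N) : ℝ :=
  (mvfderiv I (fun p ↦ A.fundamentalForm p (Y p) (Z p)) x (X x)
    + mvfderiv I (fun p ↦ A.fundamentalForm p (Z p) (X p)) x (Y x)
    + mvfderiv I (fun p ↦ A.fundamentalForm p (X p) (Y p)) x (Z x)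
    - A.fundamentalForm x (VectorField.mlieBracket I X Y x) (Z x)
    - A.fundamentalForm x (VectorField.mlieBracket I Y Z x) (X x)
    - A.fundamentalForm x (VectorField.mlieBracket I Z X x) (Y x)) / 3

/-- The Nijenhuis tensor
`N(X, Y) = [φX, φY] + φ²[X, Y] - φ[φX, Y] - φ[X, φY] + 2 dη(X, Y) ξ`. -/
def nijenhuis (A : AlmostContactMetric I N) (X Y : Π x : N, TangentSpace I x) (x : N) :
    TangentSpace I x :=
  VectorField.mlieBracket I (fun p ↦ A.φ p (X p)) (fun p ↦ A.φ p (Y p)) x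
    + A.φ x (A.φ x (VectorField.mlieBracket I X Y x))
    - A.φ x (VectorField.mlieBracket I (fun p ↦ A.φ p (X p)) Y x)
    - A.φ x (VectorField.mlieBracket I X (fun p ↦ A.φ p (Y p)) x)
    + (2 * A.dη X Y x) • A.ξ x

/-- An almost contact metric manifold with Levi-Civita connection `cov` is SQ-Sasakian (special
quasi-Sasakian) with structure function `β` if it is normal, `dΦ = 0`, `∇_X ξ = -β φX` and
`ξ β = 0`, where `β` is a smooth function. -/
structure IsSQSasakian (A : AlmostContactMetric I N)
    (cov : CovariantDerivative I E (TangentSpace I : N → Type _)) (β : N → ℝ) : Prop where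
  contMDiff_β : ContMDiff I 𝓘(ℝ) ∞ β
  normal : ∀ X Y : Π x : N, TangentSpace I x, CMDiff ∞ (T% X) → CMDiff ∞ (T% Y) →
    ∀ x, A.nijenhuis X Y x = 0
  closed : ∀ X Y Z : Π x : N, TangentSpace I x,
    CMDiff ∞ (T% X) → CMDiff ∞ (T% Y) → CMDiff ∞ (T% Z) → ∀ x, A.dΦ X Y Z x = 0
  cov_ξ : ∀ x (u : TangentSpace I x), cov A.ξ x u = -(β x • A.φ x u)
  ξ_β : ∀ x, mvfderiv I β x (A.ξ x) = 0

end AlmostContactMetric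

end Contact

/-! ### Submanifolds -/

section Submanifolds

variable {E : Type*} [NormedAddCommGroup E] [NormedSpace ℝ E]
  {H : Type*} [TopologicalSpace H] {I : ModelWithCorners ℝ E H}
  {M : Type*} [TopologicalSpace M] [ChartedSpace H M] [IsManifold I ∞ M]
  [RiemannianBundle (fun x : M ↦ TangentSpace I x)]
  {E' : Type*} [NormedAddCommGroup E'] [NormedSpace ℝ E']
  {H' : Type*} [TopologicalSpace H'] {J : ModelWithCorners ℝ E' H'}
  {N : Type*} [TopologicalSpace N] [ChartedSpace H' N] [IsManifold J ∞ N]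
  [RiemannianBundle (fun x : N ↦ TangentSpace J x)]

variable (I J) in
/-- `M` is an (immersed) Riemannian submanifold of `N` through `f`: the map `f` is a smooth
immersion, and the metric of `M` is the one induced by the metric of `N`. -/
structure IsRiemannianSubmanifold (f : M → N) : Prop where
  isImmersion : IsImmersion I J ∞ f
  inner_mfderiv : ∀ (x : M) (u v : TangentSpace I x),
    inner ℝ (mfderiv I J f x u) (mfderiv I J f x v) = inner ℝ u v

/-- The connection `cov` on the submanifold `M` is induced by the connection `cov'` of the ambient
manifold: `∇_v Y` is the tangential component of `∇'_v Y'` for every vector field `Y'` of the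
ambient manifold which extends `Y` near the point (a tangent vector of `M` is the tangential
component of `a` if and only if it has the same inner products as `a` with all tangent vectors
of `M`). -/
def IsInducedConnection (f : M → N)
    (cov' : CovariantDerivative J E' (TangentSpace J : N → Type _))
    (cov : CovariantDerivative I E (TangentSpace I : M → Type _)) : Prop :=
  ∀ (x : M) (Y : Π x : M, TangentSpace I x) (Y' : Π y : N, TangentSpace J y),
    MDiffAt (T% Y) x → MDiffAt (T% Y') (f x) →
    (∀ᶠ p in 𝓝 x, Y' (f p) = mfderiv I J f p (Y p)) →
    ∀ v w : TangentSpace I x,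
      inner ℝ (cov Y x v) w
        = inner ℝ (cov' Y' (f x) (mfderiv I J f x v)) (mfderiv I J f x w)

variable (I) in
/-- `M` is anti-invariant: `φX` is normal to `M` for every `X` tangent to `M`. -/
def AlmostContactMetric.IsAntiInvariant (A : AlmostContactMetric J N) (f : M → N) : Prop :=
  ∀ (x : M) (u v : TangentSpace I x),
    inner ℝ (A.φ (f x) (mfderiv I J f x u)) (mfderiv I J f x v) = 0

variable (I) in
/-- The vector field `ξM` of `M` is the structure vector field `ξ`, which is tangent to `M`. -/
def AlmostContactMetric.IsTangentStructureField (A : AlmostContactMetric J N) (f : M → N)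
    (ξM : Π x : M, TangentSpace I x) : Prop :=
  ∀ x : M, mfderiv I J f x (ξM x) = A.ξ (f x)

variable (I) in
/-- The restriction of `η` to `M`. -/
def AlmostContactMetric.restrictη (A : AlmostContactMetric J N) (f : M → N) (x : M) :
    TangentSpace I x →L[ℝ] ℝ :=
  (A.η (f x)).comp (mfderiv I J f x)

variable (I) in
/-- The restriction of the fundamental two-form `Φ` to `M`. -/
def AlmostContactMetric.restrictΦ (A : AlmostContactMetric J N) (f : M → N) (x : M)
    (u v : TangentSpace I x) : ℝ :=
  A.fundamentalForm (f x) (mfderiv I J f x u) (mfderiv I J f x v)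

end Submanifolds

end

/-! Write `∇` for the Levi-Civita connection of `M` and `∇'` for the induced one. A metric
connection is determined by its torsion, so on `N` the semisymmetric connection differs from
Levi-Civita by `η(Y)X - g(X,Y)ξ`. Hence the ambient derivative of `ξ` along `X` is `-βφX + X -
η(X)ξ`. For `X` tangent to `M`, anti-invariance makes `φX` normal, so `∇'_X ξ = X - η(X)ξ`. On the
other hand `∇'` is itself metric with semisymmetric torsion (`IsMetricConnection.of_induced`,
`IsInducedConnection.inner_torsion`), so it differs from `∇` by the same kind of term, which at `Y =
ξ` is already `X - η(X)ξ`. Therefore `∇ξ = 0` on `M`.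

For parallel unit `ξ` the curvatures of `∇'` and `∇` differ by an algebraic term, whose trace gives
`S' = S + (dim M - 2)(η⊗η - g)` (`IsLeviCivita.semisymmetric_ricci`) with `dim M - 2 = 2m - 1`. The
soliton equation reads `(g - η⊗η) + S' + λg = 0` and can be solved for `S`. The `Φ` term is zero on
`M`.

Much of the work is regularity: induced connections are tested on local ambient extensions of vector
fields, and no connection is assumed smooth, so differentiability of `∇_Y Z` is extracted from the
Koszul formula. -/

/-! ### Lie brackets of related vector fields -/

-- Differentiating `V' ∘ F = dF · V` along `v` gives `DV'(dF v) = D²F(v, V) + dF(DV v)`. In the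
-- bracket the second-derivative terms cancel because `D²F` is symmetric.
open Set VectorField Filter in
theorem VectorField.lieBracket_of_related
    {E : Type*} [NormedAddCommGroup E] [NormedSpace ℝ E]
    {E' : Type*} [NormedAddCommGroup E'] [NormedSpace ℝ E']
    {F : E → E'} {V W : E → E} {V' W' : E' → E'} {z : E}
    (hF : ContDiffAt ℝ 2 F z) (hV : DifferentiableAt ℝ V z) (hW : DifferentiableAt ℝ W z)
    (hV' : DifferentiableAt ℝ V' (F z)) (hW' : DifferentiableAt ℝ W' (F z))
    (hVV' : ∀ᶠ y in 𝓝 z, V' (F y) = fderiv ℝ F y (V y))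
    (hWW' : ∀ᶠ y in 𝓝 z, W' (F y) = fderiv ℝ F y (W y)) :
    lieBracket ℝ V' W' (F z) = fderiv ℝ F z (lieBracket ℝ V W z) := by
  have hF1 : DifferentiableAt ℝ F z := hF.differentiableAt two_ne_zero
  have hdF : DifferentiableAt ℝ (fderiv ℝ F) z :=
    (hF.fderiv_right (m := 1) le_rfl).differentiableAt one_ne_zero
  have key : ∀ {U : E → E} {U' : E' → E'}, DifferentiableAt ℝ U z →
      DifferentiableAt ℝ U' (F z) → (∀ᶠ y in 𝓝 z, U' (F y) = fderiv ℝ F y (U y)) → ∀ v,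
      fderiv ℝ U' (F z) (fderiv ℝ F z v)
        = fderiv ℝ (fderiv ℝ F) z v (U z) + fderiv ℝ F z (fderiv ℝ U z v) := by
    intro U U' hU hU' h v
    have h1 : fderiv ℝ (U' ∘ F) z = fderiv ℝ (fun y ↦ fderiv ℝ F y (U y)) z :=
      Filter.EventuallyEq.fderiv_eq h
    rw [fderiv_comp z hU' hF1, fderiv_clm_apply hdF hU] at h1
    have := congr($h1 v)
    simp at this
    rw [this, add_comm]
  have hs : IsSymmSndFDerivAt ℝ F z := hF.isSymmSndFDerivAt (by simp)
  simp only [lieBracket]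
  rw [hVV'.self_of_nhds, hWW'.self_of_nhds, key hV hV' hVV', key hW hW' hWW', map_sub,
    hs.eq (W z) (V z)]
  abel

section Related

variable {E : Type*} [NormedAddCommGroup E] [NormedSpace ℝ E]
  {H : Type*} [TopologicalSpace H] {I : ModelWithCorners ℝ E H}
  {M : Type*} [TopologicalSpace M] [ChartedSpace H M]
  {E' : Type*} [NormedAddCommGroup E'] [NormedSpace ℝ E']
  {H' : Type*} [TopologicalSpace H'] {J : ModelWithCorners ℝ E' H'}
  {N : Type*} [TopologicalSpace N] [ChartedSpace H' N]

theorem mpullbackWithin_extChartAt_symm_apply [I.Boundaryless] [IsManifold I 1 M] (x : M)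
    (V : Π x : M, TangentSpace I x)
    {y : E} (hy : y ∈ (extChartAt I x).target) :
    VectorField.mpullbackWithin 𝓘(ℝ, E) I (extChartAt I x).symm V (Set.range I) y
      = mfderiv I 𝓘(ℝ, E) (extChartAt I x) ((extChartAt I x).symm y)
          (V ((extChartAt I x).symm y)) := by
  rw [VectorField.mpullbackWithin_apply]
  congr 1
  apply ContinuousLinearMap.inverse_eq
  · exact mfderivWithin_extChartAt_symm_comp_mfderiv_extChartAt hy
  · exact mfderiv_extChartAt_comp_mfderivWithin_extChartAt_symm hy

theorem mlieBracket_eq_inverse_mfderiv_extChartAt [I.Boundaryless] (V W : Π x : M, TangentSpace I x)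
    (x : M) :
    VectorField.mlieBracket I V W x = (mfderiv I 𝓘(ℝ, E) (extChartAt I x) x).inverse
      (VectorField.lieBracket (E := E) ℝ
        (VectorField.mpullbackWithin 𝓘(ℝ, E) I (extChartAt I x).symm V (Set.range I))
        (VectorField.mpullbackWithin 𝓘(ℝ, E) I (extChartAt I x).symm W (Set.range I))
        (extChartAt I x x)) := by
  rw [← VectorField.mlieBracketWithin_univ, VectorField.mlieBracketWithin_apply]
  refine congrArg _ ?_
  rw [Set.preimage_univ, Set.univ_inter, I.range_eq_univ]
  exact congrFun VectorField.lieBracketWithin_univ _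

/-- The Lie brackets of vector fields which are related through `f` are related through `f`. -/
theorem mlieBracket_of_related [I.Boundaryless] [J.Boundaryless] [IsManifold I 2 M]
    [IsManifold J 2 N] [CompleteSpace E] [CompleteSpace E']
    {f : M → N} {x : M} {V W : Π x : M, TangentSpace I x} {V' W' : Π y : N, TangentSpace J y}
    (hf : ContMDiffAt I J 2 f x) (hV : MDiffAt (T% V) x) (hW : MDiffAt (T% W) x)
    (hV' : MDiffAt (T% V') (f x)) (hW' : MDiffAt (T% W') (f x))
    (hVV' : ∀ᶠ p in 𝓝 x, V' (f p) = mfderiv I J f p (V p))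
    (hWW' : ∀ᶠ p in 𝓝 x, W' (f p) = mfderiv I J f p (W p)) :
    VectorField.mlieBracket J V' W' (f x)
      = mfderiv I J f x (VectorField.mlieBracket I V W x) := by
  have : IsManifold I 1 M := .of_le one_le_two
  have : IsManifold J 1 N := .of_le one_le_two
  set z := extChartAt I x x with hz
  set F : E → E' := extChartAt J (f x) ∘ f ∘ (extChartAt I x).symm with hFdef
  have hFz : F z = extChartAt J (f x) (f x) := by simp [F, z]
  have hsz : (extChartAt I x).symm z = x := by simp [z]
  have hFsm : ContDiffAt ℝ 2 F z := by
    have := (contMDiffAt_iff.1 hf).2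
    rwa [I.range_eq_univ, contDiffWithinAt_univ] at this
  have hfd : ∀ᶠ p in 𝓝 x, MDifferentiableAt I J f p := by
    filter_upwards [(contMDiffAt_iff_contMDiffAt_nhds (by simp)).1 hf] with p hp
    exact hp.mdifferentiableAt two_ne_zero
  have hcont : Filter.Tendsto (extChartAt I x).symm (𝓝 z) (𝓝 x) := by
    have := continuousAt_extChartAt_symm (I := I) x
    rwa [ContinuousAt, extChartAt_to_inv] at this
  have htarget : ∀ᶠ y in 𝓝 z, y ∈ (extChartAt I x).target := extChartAt_target_mem_nhds x
  have hsource : ∀ᶠ p in 𝓝 x, f p ∈ (extChartAt J (f x)).source :=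
    hf.continuousAt.eventually (extChartAt_source_mem_nhds (f x))
  -- Both sides are the derivative of the chart of `N` composed with `f`, which near the point is
  -- also `F` composed with the chart of `M`.
  have hderiv : ∀ᶠ y in 𝓝 z, ∀ u : TangentSpace I ((extChartAt I x).symm y),
      fderiv ℝ F y (mfderiv I 𝓘(ℝ, E) (extChartAt I x) ((extChartAt I x).symm y) u)
        = mfderiv J 𝓘(ℝ, E') (extChartAt J (f x)) (f ((extChartAt I x).symm y))
            (mfderiv I J f ((extChartAt I x).symm y) u) := by
    filter_upwards [htarget, hcont.eventually hfd, hcont.eventually hsource,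
      hFsm.eventually (by simp)] with y hy h1 h2 h3
    set p := (extChartAt I x).symm y with hp
    have hps : p ∈ (extChartAt I x).source := (extChartAt I x).map_target hy
    have hpy : extChartAt I x p = y := (extChartAt I x).right_inv hy
    have e1 : HasMFDerivAt I 𝓘(ℝ, E') (extChartAt J (f x) ∘ f) p
        ((mfderiv J 𝓘(ℝ, E') (extChartAt J (f x)) (f p)).comp (mfderiv I J f p)) :=
      HasMFDerivAt.comp p (mdifferentiableAt_extChartAt (by simpa using h2)).hasMFDerivAt
        h1.hasMFDerivAt
    have e2 : HasMFDerivAt I 𝓘(ℝ, E') (F ∘ extChartAt I x) p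
        ((fderiv ℝ F y).comp (mfderiv I 𝓘(ℝ, E) (extChartAt I x) p)) := by
      refine HasMFDerivAt.comp p ?_ (mdifferentiableAt_extChartAt (by simpa using hps)).hasMFDerivAt
      rw [hpy]
      exact (h3.differentiableAt two_ne_zero).hasFDerivAt.hasMFDerivAt
    have e3 : F ∘ extChartAt I x =ᶠ[𝓝 p] extChartAt J (f x) ∘ f := by
      filter_upwards [(isOpen_extChartAt_source (I := I) x).mem_nhds hps] with q hq
      simp only [F, Function.comp_apply, (extChartAt I x).left_inv hq]
    intro u
    exact (DFunLike.congr_fun (hasMFDerivAt_unique (e1.congr_of_eventuallyEq e3) e2) u).symm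
  -- Relatedness through `f` becomes relatedness through `F` of the chart representatives, which
  -- reduces the claim to the vector space case.
  have hrel : ∀ {U : Π x : M, TangentSpace I x} {U' : Π y : N, TangentSpace J y},
      (∀ᶠ p in 𝓝 x, U' (f p) = mfderiv I J f p (U p)) → ∀ᶠ y in 𝓝 z,
      VectorField.mpullbackWithin 𝓘(ℝ, E') J (extChartAt J (f x)).symm U' (Set.range J) (F y)
        = fderiv ℝ F y
          (VectorField.mpullbackWithin 𝓘(ℝ, E) I (extChartAt I x).symm U (Set.range I) y) := by
    intro U U' h
    filter_upwards [htarget, hcont.eventually h, hcont.eventually hsource, hderiv]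
      with y hy h1 h2 h3
    have hFy : (extChartAt J (f x)).symm (F y) = f ((extChartAt I x).symm y) := by
      simp only [F, Function.comp_apply, (extChartAt J (f x)).left_inv h2]
    have hFt : F y ∈ (extChartAt J (f x)).target := (extChartAt J (f x)).map_source h2
    rw [mpullbackWithin_extChartAt_symm_apply x U hy,
      mpullbackWithin_extChartAt_symm_apply (f x) U' hFt, hFy, h1]
    exact (h3 _).symm
  have hdiff : ∀ {U : Π x : M, TangentSpace I x}, MDiffAt (T% U) x → DifferentiableAt ℝ
      (VectorField.mpullbackWithin 𝓘(ℝ, E) I (extChartAt I x).symm U (Set.range I)) z := by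
    intro U hU
    rw [← mdifferentiableWithinAt_univ] at hU
    have := hU.differentiableWithinAt_mpullbackWithin_vectorField
    rw [I.range_eq_univ] at this ⊢
    rw [Set.preimage_univ, Set.univ_inter] at this
    exact differentiableWithinAt_univ.1 this
  have hdiff' : ∀ {U : Π y : N, TangentSpace J y}, MDiffAt (T% U) (f x) → DifferentiableAt ℝ
      (VectorField.mpullbackWithin 𝓘(ℝ, E') J (extChartAt J (f x)).symm U (Set.range J)) (F z) := by
    intro U hU
    rw [← mdifferentiableWithinAt_univ] at hU
    have := hU.differentiableWithinAt_mpullbackWithin_vectorField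
    rw [hFz]
    rw [J.range_eq_univ] at this ⊢
    rw [Set.preimage_univ, Set.univ_inter] at this
    exact differentiableWithinAt_univ.1 this
  have key := VectorField.lieBracket_of_related hFsm (hdiff hV) (hdiff hW) (hdiff' hV')
    (hdiff' hW') (hrel hVV') (hrel hWW')
  have hd := hderiv.self_of_nhds
  rw [hFz] at key
  rw [mlieBracket_eq_inverse_mfderiv_extChartAt, mlieBracket_eq_inverse_mfderiv_extChartAt]
  have hinv := isInvertible_mfderiv_extChartAt (I := I) (mem_extChartAt_source x)
  have hinv' := isInvertible_mfderiv_extChartAt (I := J) (mem_extChartAt_source (f x))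
  refine hinv'.inverse_apply_eq.2 (key.trans ?_)
  rw [hsz] at hd
  refine Eq.trans ?_ (hd _)
  exact congrArg (fderiv ℝ F z) (hinv.inverse_apply_eq.1 rfl)

end Related

/-! ### Vector fields along an immersion -/

section Immersion

variable {E : Type*} [NormedAddCommGroup E] [NormedSpace ℝ E]
  {H : Type*} [TopologicalSpace H] {I : ModelWithCorners ℝ E H}
  {M : Type*} [TopologicalSpace M] [ChartedSpace H M]
  {E' : Type*} [NormedAddCommGroup E'] [NormedSpace ℝ E']
  {H' : Type*} [TopologicalSpace H'] {J : ModelWithCorners ℝ E' H'}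
  {N : Type*} [TopologicalSpace N] [ChartedSpace H' N]

/-- The case `n = ∞` is excluded because being `C^∞` at a point only gives, for each finite `k`, a
neighbourhood where the map is `C^k`, and the proof needs one neighbourhood. Shrinking it to an open
set turns `tangentMapWithin` into `tangentMap`. -/
theorem ContMDiffAt.contMDiffAt_tangentMap {m n : ℕ∞ω} [IsManifold I 1 M] [IsManifold J 1 N]
    [IsManifold I n M] [IsManifold J n N]
    {f : M → N} {p : TangentBundle I M} (hf : ContMDiffAt I J n f p.1)
    (hn : n ≠ ∞) (hmn : m + 1 ≤ n) :
    ContMDiffAt I.tangent J.tangent m (tangentMap I J f) p := by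
  obtain ⟨u, hu, hfu⟩ := (contMDiffAt_iff_contMDiffOn_nhds hn).1 hf
  obtain ⟨v, hvu, hv, hpv⟩ := mem_nhds_iff.1 hu
  have h1 := (hfu.mono hvu).contMDiffOn_tangentMapWithin hmn hv.uniqueMDiffOn
  have hv' : TotalSpace.proj ⁻¹' v ∈ 𝓝 p :=
    (hv.preimage (FiberBundle.continuous_proj E (TangentSpace I))).mem_nhds hpv
  refine (h1.contMDiffAt hv').congr_of_eventuallyEq ?_
  filter_upwards [hv'] with q hq
  exact (tangentMapWithin_eq_tangentMap (hv.uniqueMDiffOn q.1 hq)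
    (((hfu.mono hvu).contMDiffAt (hv.mem_nhds hq)).mdifferentiableAt (by
      rintro rfl; simp at hmn))).symm

theorem Manifold.IsImmersionAt.of_le {m n : ℕ∞ω} {f : M → N} {x : M} (h : IsImmersionAt I J n f x)
    (hmn : m ≤ n) : IsImmersionAt I J m f x := by
  refine ⟨h.complement, inferInstance, inferInstance, ?_⟩
  exact IsImmersionAtOfComplement.mk_of_charts h.equiv h.domChart h.codChart h.mem_domChart_source
    h.mem_codChart_source (IsManifold.maximalAtlas_subset_of_le hmn h.domChart_mem_maximalAtlas)
    (IsManifold.maximalAtlas_subset_of_le hmn h.codChart_mem_maximalAtlas)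
    h.source_subset_preimage_source h.writtenInCharts

/-- An immersion has a smooth local left inverse. -/
theorem Manifold.IsImmersionAt.exists_local_left_inverse [I.Boundaryless] {n : ℕ∞ω}
    [IsManifold I n M] [IsManifold J n N]
    {f : M → N} {x : M} (h : IsImmersionAt I J n f x) :
    ∃ r : N → M, ContMDiffAt J I n r (f x) ∧ ∀ᶠ p in 𝓝 x, r (f p) = p := by
  have hw : ∀ p ∈ h.domChart.source, h.codChart.extend J (f p)
      = h.equiv (h.domChart.extend I p, 0) := by
    intro p hp
    have hp' : p ∈ (h.domChart.extend I).source := by simpa using hp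
    have := h.writtenInCharts ((h.domChart.extend I).map_source hp')
    simpa only [Function.comp_apply, (h.domChart.extend I).left_inv hp'] using this
  -- In adapted charts the immersion is `u ↦ (u, 0)`, and the left inverse is the projection to the
  -- first factor.
  refine ⟨fun y ↦ (h.domChart.extend I).symm (h.equiv.symm (h.codChart.extend J y)).1, ?_, ?_⟩
  · have h1 : ContMDiffAt J 𝓘(ℝ, E') n (h.codChart.extend J) (f x) :=
      h.codChart.contMDiffAt_extend h.codChart_mem_maximalAtlas h.mem_codChart_source
    have h2 : ContMDiffAt J 𝓘(ℝ, E) n (fun y ↦ (h.equiv.symm (h.codChart.extend J y)).1) (f x) := by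
      have : ContDiff ℝ n fun z ↦ (h.equiv.symm z).1 := by fun_prop
      exact this.contMDiff.contMDiffAt.comp (f x) h1
    have h3 : (h.equiv.symm (h.codChart.extend J (f x))).1 = h.domChart.extend I x := by
      rw [hw x h.mem_domChart_source]; simp
    have h4 : ContMDiffAt 𝓘(ℝ, E) I n (h.domChart.extend I).symm (h.domChart.extend I x) := by
      refine (contMDiffOn_extend_symm h.domChart_mem_maximalAtlas).contMDiffAt ?_
      rw [I.image_eq, ← h.domChart.extend_target]
      exact h.domChart.isOpen_extend_target.mem_nhds ((h.domChart.extend I).map_source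
        (by simpa using h.mem_domChart_source))
    exact h4.comp_of_eq h2 h3
  · filter_upwards [h.domChart.open_source.mem_nhds h.mem_domChart_source] with p hp
    rw [hw p hp]
    simpa using h.domChart.left_inv hp

/-- Vector fields along an immersion extend locally to vector fields of the ambient manifold. -/
theorem Manifold.IsImmersionAt.exists_related_vectorField [I.Boundaryless]
    [IsManifold I 2 M] [IsManifold J 2 N]
    {f : M → N} {x : M} (h : IsImmersionAt I J 2 f x) {Y : Π x : M, TangentSpace I x}
    (hY : MDiffAt (T% Y) x) :
    ∃ Y' : Π y : N, TangentSpace J y, MDiffAt (T% Y') (f x) ∧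
      ∀ᶠ p in 𝓝 x, Y' (f p) = mfderiv I J f p (Y p) := by
  have : IsManifold I 1 M := .of_le one_le_two
  have : IsManifold J 1 N := .of_le one_le_two
  obtain ⟨r, hr, hrf⟩ := h.exists_local_left_inverse
  let e := trivializationAt E' (TangentSpace J) (f x)
  have hx : f x ∈ e.baseSet := FiberBundle.mem_baseSet_trivializationAt' (f x)
  let G : N → TangentBundle J N := fun y ↦ tangentMap I J f (T% Y (r y))
  have hG : MDifferentiableAt J J.tangent G (f x) := by
    have h1 : MDifferentiableAt I.tangent J.tangent (tangentMap I J f) (T% Y x) :=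
      (ContMDiffAt.contMDiffAt_tangentMap (m := 1) (n := 2) h.contMDiffAt (by simp)
        le_rfl).mdifferentiableAt one_ne_zero
    have h2 := h1.comp x hY
    exact h2.comp_of_eq (f x) (hr.mdifferentiableAt two_ne_zero) hrf.self_of_nhds
  -- `G y` is based at `f (r y)`, which need not be `y` off the image of `f`. Its fibre coordinate
  -- in the trivialization is therefore transplanted to the fibre over `y`; on the image near `f x`
  -- nothing changes.
  refine ⟨fun y ↦ e.symm y (e (G y)).2, ?_, ?_⟩
  · rw [e.mdifferentiableAt_section_iff J _ hx]
    have hG0 : G (f x) ∈ e.source := by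
      rw [e.mem_source]
      simpa [G, hrf.self_of_nhds] using hx
    refine ((e.mdifferentiableAt_totalSpace_iff J G hG0).1 hG).2.congr_of_eventuallyEq ?_
    filter_upwards [e.open_baseSet.mem_nhds hx] with y hy
    simp [e.apply_mk_symm hy]
  · filter_upwards [hrf, h.contMDiffAt.continuousAt.eventually (e.open_baseSet.mem_nhds hx)]
      with p hp hpe
    have : G (f p) = ⟨f p, mfderiv I J f p (Y p)⟩ :=
      congrArg (fun q ↦ tangentMap I J f (T% Y q)) hp
    simp [this, e.symm_apply_apply_mk hpe]

/-- If `r` is a smooth local left inverse of `f`, then `Y = dr(Y' ∘ f)` near the point. This makes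
the structure field of `M` smooth, although it is only specified through its image under `df`. -/
theorem Manifold.IsImmersionAt.contMDiffAt_of_related [I.Boundaryless] [IsManifold I ∞ M]
    [IsManifold J ∞ N] {f : M → N} {x : M} (h : IsImmersionAt I J ∞ f x)
    {Y : Π x : M, TangentSpace I x} {Y' : Π y : N, TangentSpace J y}
    (hY' : ContMDiffAt J J.tangent ∞ (T% Y') (f x))
    (hYY' : ∀ᶠ p in 𝓝 x, Y' (f p) = mfderiv I J f p (Y p)) :
    ContMDiffAt I I.tangent ∞ (T% Y) x := by
  obtain ⟨r, hr, hrf⟩ := h.exists_local_left_inverse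
  have hf := h.contMDiffAt
  have hr1 : ∀ᶠ p in 𝓝 x, MDifferentiableAt J I r (f p) := by
    have := (contMDiffAt_iff_contMDiffAt_nhds (n := 1) (by simp)).1 (hr.of_le (by simp))
    filter_upwards [hf.continuousAt.eventually this] with p hp
    exact hp.mdifferentiableAt one_ne_zero
  have hf1 : ∀ᶠ p in 𝓝 x, MDifferentiableAt I J f p := by
    have := (contMDiffAt_iff_contMDiffAt_nhds (n := 1) (by simp)).1 (hf.of_le (by simp))
    filter_upwards [this] with p hp
    exact hp.mdifferentiableAt one_ne_zero
  have key : (T% Y) =ᶠ[𝓝 x] fun p ↦ tangentMap J I r (T% Y' (f p)) := by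
    filter_upwards [hrf.eventually_nhds, hr1, hf1, hYY'] with p hp h1 h2 h3
    have h4 : HasMFDerivAt I I (r ∘ f) p ((mfderiv J I r (f p)).comp (mfderiv I J f p)) :=
      HasMFDerivAt.comp p h1.hasMFDerivAt h2.hasMFDerivAt
    have h5 : HasMFDerivAt I I (r ∘ f) p (ContinuousLinearMap.id ℝ (TangentSpace I p)) :=
      (hasMFDerivAt_id p).congr_of_eventuallyEq hp
    have h6 := DFunLike.congr_fun (hasMFDerivAt_unique h5 h4) (Y p)
    have h7 : tangentMap J I r (T% Y' (f p))
        = (⟨r (f p), mfderiv J I r (f p) (Y' (f p))⟩ : TangentBundle I M) := rfl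
    rw [h7, h3, hp.self_of_nhds]
    exact congrArg (TotalSpace.mk p) h6
  refine ContMDiffAt.congr_of_eventuallyEq ?_ key
  -- The regularity of the tangent map of `r` is available only at finite orders, so each `k` is
  -- treated separately.
  rw [contMDiffAt_infty]
  intro k
  have h1 : ContMDiffAt J.tangent I.tangent k (tangentMap J I r) (T% Y' (f x)) :=
    ContMDiffAt.contMDiffAt_tangentMap (n := (k + 1 : ℕ)) (hr.of_le (by exact_mod_cast le_top))
      (by simp) (by simp)
  exact h1.comp x ((hY'.of_le (by exact_mod_cast le_top)).comp x
    (hf.of_le (by exact_mod_cast le_top)))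

end Immersion

/-! ### Metric connections and their torsion -/

/-- Alternating the two symmetries six times returns to `b u v w` with the opposite sign. This is
the algebra behind uniqueness of the Levi-Civita connection. -/
theorem eq_zero_of_skew_of_symm {α : Type*} {b : α → α → α → ℝ}
    (hskew : ∀ u v w, b u v w = -b u w v) (hsymm : ∀ u v w, b u v w = b v u w) (u v w : α) :
    b u v w = 0 := by
  linarith [hsymm u v w, hskew v u w, hsymm v w u, hskew w v u, hsymm w u v, hskew u w v]

section MetricConnections

variable {E : Type*} [NormedAddCommGroup E] [NormedSpace ℝ E]
  {H : Type*} [TopologicalSpace H] {I : ModelWithCorners ℝ E H}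
  {M : Type*} [TopologicalSpace M] [ChartedSpace H M] [IsManifold I ∞ M]
  [FiniteDimensional ℝ E] [RiemannianBundle (fun x : M ↦ TangentSpace I x)]

/-- A metric connection is determined by its torsion: the case where the torsions of two metric
connections differ by a semisymmetric term. -/
theorem IsMetricConnection.apply_eq_add_of_torsion
    {cov cov' : CovariantDerivative I E (TangentSpace I : M → Type _)}
    (hcov : IsMetricConnection cov) (hcov' : IsMetricConnection cov') {x : M}
    (ζ : TangentSpace I x)
    (ht : ∀ u v : TangentSpace I x, cov'.torsion x u v
      = cov.torsion x u v + (inner ℝ v ζ • u - inner ℝ u ζ • v))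
    {Y : Π x : M, TangentSpace I x} (hY : MDiffAt (T% Y) x) (u : TangentSpace I x) :
    cov' Y x u = cov Y x u + (inner ℝ (Y x) ζ • u - inner ℝ u (Y x) • ζ) := by
  let D : TangentSpace I x →L[ℝ] TangentSpace I x →L[ℝ] TangentSpace I x :=
    IsCovariantDerivativeOn.difference cov'.isCovariantDerivativeOnUniv
      cov.isCovariantDerivativeOnUniv x
  have hD : ∀ {Z : Π x : M, TangentSpace I x}, MDiffAt (T% Z) x → ∀ v,
      D (Z x) v = cov' Z x v - cov Z x v := fun hZ v ↦
    DFunLike.congr_fun (IsCovariantDerivativeOn.difference_apply cov'.isCovariantDerivativeOnUniv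
      cov.isCovariantDerivativeOnUniv trivial hZ) v
  have hext : ∀ v : TangentSpace I x, MDiffAt (T% (FiberBundle.extend E v)) x :=
    fun v ↦ FiberBundle.mdifferentiableAt_extend I E v
  -- In `D v u` the differentiated field is `v` and the direction is `u`. Metricity of both
  -- connections makes each `D · u` skew-adjoint.
  have hskew : ∀ u v w : TangentSpace I x, inner ℝ (D v u) w = -inner ℝ (D w u) v := by
    intro u v w
    have h1 := hcov x _ _ (hext v) (hext w) u
    have h2 := hcov' x _ _ (hext v) (hext w) u
    have h3 := hD (hext v) u
    have h4 := hD (hext w) u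
    rw [FiberBundle.extend_apply_self] at h3 h4
    rw [FiberBundle.extend_apply_self, FiberBundle.extend_apply_self] at h1 h2
    rw [h3, h4, inner_sub_left, inner_sub_left]
    rw [real_inner_comm _ v] at h1 h2
    linarith
  have htor : ∀ u v : TangentSpace I x, D v u - D u v = inner ℝ v ζ • u - inner ℝ u ζ • v := by
    intro u v
    have h1 := hD (hext v) u
    have h2 := hD (hext u) v
    have h3 := ht u v
    rw [CovariantDerivative.torsion_apply_eq_extend, CovariantDerivative.torsion_apply_eq_extend]
      at h3
    rw [FiberBundle.extend_apply_self] at h1 h2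
    rw [FiberBundle.extend_apply_self, FiberBundle.extend_apply_self] at h3
    rw [h1, h2]
    have h4 := eq_sub_of_add_eq' h3.symm
    rw [h4]
    abel
  -- The candidate correction has the same skewness and the same antisymmetrization as `D`, so what
  -- remains after subtracting it is skew in one pair and symmetric in another.
  have key : ∀ v w : TangentSpace I x,
      inner ℝ (D v u) w - (inner ℝ v ζ * inner ℝ u w - inner ℝ u v * inner ℝ w ζ) = 0 := by
    refine eq_zero_of_skew_of_symm (b := fun u v w : TangentSpace I x ↦
      inner ℝ (D v u) w - (inner ℝ v ζ * inner ℝ u w - inner ℝ u v * inner ℝ w ζ)) ?_ ?_ u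
    · intro u v w
      simp only [hskew u v w]
      ring
    · intro u v w
      have := congrArg (fun a ↦ inner ℝ a w) (htor u v)
      simp only [inner_sub_left, real_inner_smul_left] at this
      simp only [real_inner_comm u v] at this ⊢
      linarith
  have h1 : D (Y x) u = inner ℝ (Y x) ζ • u - inner ℝ u (Y x) • ζ := by
    refine ext_inner_right ℝ fun w ↦ ?_
    have := key (Y x) w
    simp only [inner_sub_left, real_inner_smul_left]
    rw [real_inner_comm w ζ] 
    linarith
  rw [← h1, hD hY]
  abel

end MetricConnections

/-! ### Connections induced on a submanifold -/

section Induced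

variable {E : Type*} [NormedAddCommGroup E] [NormedSpace ℝ E] [FiniteDimensional ℝ E]
  {H : Type*} [TopologicalSpace H] {I : ModelWithCorners ℝ E H} [I.Boundaryless]
  {M : Type*} [TopologicalSpace M] [ChartedSpace H M] [IsManifold I ∞ M]
  [RiemannianBundle (fun x : M ↦ TangentSpace I x)]
  {E' : Type*} [NormedAddCommGroup E'] [NormedSpace ℝ E'] [FiniteDimensional ℝ E']
  {H' : Type*} [TopologicalSpace H'] {J : ModelWithCorners ℝ E' H'} [J.Boundaryless]
  {N : Type*} [TopologicalSpace N] [ChartedSpace H' N] [IsManifold J ∞ N]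
  [RiemannianBundle (fun x : N ↦ TangentSpace J x)]
  {f : M → N}
  {cov' : CovariantDerivative J E' (TangentSpace J : N → Type _)}
  {cov : CovariantDerivative I E (TangentSpace I : M → Type _)}

theorem IsRiemannianSubmanifold.exists_related_vectorField
    (hf : IsRiemannianSubmanifold I J f) {x : M} {Y : Π x : M, TangentSpace I x}
    (hY : MDiffAt (T% Y) x) :
    ∃ Y' : Π y : N, TangentSpace J y, MDiffAt (T% Y') (f x) ∧
      ∀ᶠ p in 𝓝 x, Y' (f p) = mfderiv I J f p (Y p) :=
  ((hf.isImmersion.isImmersionAt x).of_le (m := 2) ENat.LEInfty.out).exists_related_vectorField hY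

/-- The connection induced on a submanifold by a metric connection is metric. -/
theorem IsMetricConnection.of_induced [IsContMDiffRiemannianBundle J ∞ E' (fun y : N ↦ TangentSpace J y)]
    (hf : IsRiemannianSubmanifold I J f)
    (hcov' : IsMetricConnection cov') (hcov : IsInducedConnection f cov' cov) :
    IsMetricConnection cov := by
  have : IsContMDiffRiemannianBundle J 1 E' (fun y : N ↦ TangentSpace J y) :=
    .of_le (n := ∞) (mod_cast le_top)
  intro x Y Z hY hZ v
  obtain ⟨Y', hY', hYY'⟩ := hf.exists_related_vectorField hY
  obtain ⟨Z', hZ', hZZ'⟩ := hf.exists_related_vectorField hZ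
  have h1 := hcov x Y Y' hY hY' hYY' v (Z x)
  have h2 := hcov x Z Z' hZ hZ' hZZ' v (Y x)
  have h3 := hcov' (f x) Y' Z' hY' hZ' (mfderiv I J f x v)
  rw [hYY'.self_of_nhds, hZZ'.self_of_nhds] at h3
  rw [real_inner_comm _ (Y x), h1, h2, real_inner_comm _ (cov' Z' _ _), ← h3]
  have h4 : (fun p ↦ (inner ℝ (Y p) (Z p) : ℝ)) =ᶠ[𝓝 x]
      (fun y ↦ (inner ℝ (Y' y) (Z' y) : ℝ)) ∘ f := by
    filter_upwards [hYY', hZZ'] with p hp hp'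
    rw [Function.comp_apply, hp, hp', hf.inner_mfderiv]
  have h5 : MDifferentiableAt J 𝓘(ℝ) (fun y ↦ (inner ℝ (Y' y) (Z' y) : ℝ)) (f x) :=
    MDifferentiableAt.inner_bundle hY' hZ'
  have h6 : mvfderiv I (fun p ↦ (inner ℝ (Y p) (Z p) : ℝ)) x
      = mvfderiv I ((fun y ↦ (inner ℝ (Y' y) (Z' y) : ℝ)) ∘ f) x := h4.mfderiv_eq
  rw [h6]
  exact mvfderiv_comp_apply x h5
    ((hf.isImmersion.isImmersionAt x).contMDiffAt.mdifferentiableAt (by simp)) v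

/-- The torsion of the connection induced on a submanifold is induced by the torsion of the
connection of the ambient manifold. -/
theorem IsInducedConnection.inner_torsion
    (hf : IsRiemannianSubmanifold I J f) (hcov : IsInducedConnection f cov' cov) (x : M)
    (u v w : TangentSpace I x) :
    inner ℝ (cov.torsion x u v) w = inner ℝ
      (cov'.torsion (f x) (mfderiv I J f x u) (mfderiv I J f x v)) (mfderiv I J f x w) := by
  have hY := FiberBundle.mdifferentiableAt_extend I E u
  have hZ := FiberBundle.mdifferentiableAt_extend I E v
  set Y := FiberBundle.extend E u
  set Z := FiberBundle.extend E v
  have hYu : Y x = u := FiberBundle.extend_apply_self ..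
  have hZv : Z x = v := FiberBundle.extend_apply_self ..
  obtain ⟨Y', hY', hYY'⟩ := hf.exists_related_vectorField hY
  obtain ⟨Z', hZ', hZZ'⟩ := hf.exists_related_vectorField hZ
  have h1 := hcov x Y Y' hY hY' hYY' v w
  have h2 := hcov x Z Z' hZ hZ' hZZ' u w
  -- The bracket is the only part of the torsion not governed by the induced connection; the bracket
  -- of the extensions at `f x` is tangent to `M`.
  have h3 := mlieBracket_of_related (I := I) (J := J)
    ((hf.isImmersion.isImmersionAt x).contMDiffAt.of_le (n := ∞) ENat.LEInfty.out) hY hZ hY' hZ' hYY' hZZ'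
  have h4 : Y' (f x) = mfderiv I J f x u := by rw [hYY'.self_of_nhds, hYu]
  have h5 : Z' (f x) = mfderiv I J f x v := by rw [hZZ'.self_of_nhds, hZv]
  rw [← h4, ← h5, cov'.torsion_apply hY' hZ', h3]
  have h6 := cov.torsion_apply hY hZ
  rw [hYu, hZv] at h6
  rw [h6, h4, h5]
  simp only [inner_sub_left, h1, h2, hf.inner_mfderiv]

end Induced

/-! ### Regularity of the Levi-Civita connection -/

section LeviCivita

variable {E : Type*} [NormedAddCommGroup E] [NormedSpace ℝ E]
  {H : Type*} [TopologicalSpace H] {I : ModelWithCorners ℝ E H}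
  {M : Type*} [TopologicalSpace M] [ChartedSpace H M] [IsManifold I ∞ M]

theorem contDiff_det_of {ι : Type*} [Fintype ι] [DecidableEq ι] {F : Type*} [NormedAddCommGroup F]
    [NormedSpace ℝ F] {n : ℕ∞ω} {A : F → Matrix ι ι ℝ} (hA : ∀ i j, ContDiff ℝ n fun z ↦ A z i j) :
    ContDiff ℝ n fun z ↦ (A z).det := by
  simp only [Matrix.det_apply, Units.smul_def, zsmul_eq_mul]
  exact ContDiff.sum fun σ _ ↦ contDiff_const.mul (contDiff_prod fun l _ ↦ hA _ _)

/-- By Cramer's rule the entries of the inverse are polynomials in the entries of `G` divided by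
`det G`. It serves to solve a Gram system for the coefficients of a vector field in a frame. -/
theorem mdifferentiableAt_vecMul_inv {ι : Type} [Fintype ι] [DecidableEq ι] {x : M}
    {G : M → Matrix ι ι ℝ} {θ : M → ι → ℝ}
    (hG : ∀ i j, ContMDiffAt I 𝓘(ℝ) 1 (fun p ↦ G p i j) x)
    (hθ : ∀ i, MDifferentiableAt I 𝓘(ℝ) (fun p ↦ θ p i) x) (h0 : (G x).det ≠ 0) (i : ι) :
    MDifferentiableAt I 𝓘(ℝ) (fun p ↦ Matrix.vecMul (θ p) (G p)⁻¹ i) x := by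
  have hG' : ContMDiffAt I 𝓘(ℝ, ι → ι → ℝ) 1 (fun p i j ↦ G p i j) x :=
    contMDiffAt_pi_space.2 fun i ↦ contMDiffAt_pi_space.2 fun j ↦ hG i j
  have hadj : ∀ k j : ι, ContDiff ℝ 1 fun A : ι → ι → ℝ ↦
      ((Matrix.of A).updateRow k (Pi.single j 1)).det := by
    intro k j
    refine contDiff_det_of fun a b ↦ ?_
    simp only [Matrix.updateRow_apply]
    split_ifs
    · exact contDiff_const
    · exact contDiff_apply_apply ℝ ℝ a b
  have hdet : ContDiff ℝ 1 fun A : ι → ι → ℝ ↦ (Matrix.of A).det :=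
    contDiff_det_of fun a b ↦ contDiff_apply_apply ℝ ℝ a b
  have hinv : ContMDiffAt I 𝓘(ℝ) 1 (fun p ↦ ((G p).det)⁻¹) x := by
    have : ContDiffAt ℝ 1 (fun A : ι → ι → ℝ ↦ ((Matrix.of A).det)⁻¹) (fun i j ↦ G x i j) :=
      hdet.contDiffAt.inv h0
    exact ContMDiffAt.comp (g := fun A : ι → ι → ℝ ↦ ((Matrix.of A).det)⁻¹) x
      this.contMDiffAt hG'
  have hentry : ∀ j, MDifferentiableAt I 𝓘(ℝ) (fun p ↦ (G p)⁻¹ j i) x := by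
    intro j
    have h1 : ContMDiffAt I 𝓘(ℝ) 1 (fun p ↦ ((G p).updateRow i (Pi.single j 1)).det) x :=
      (hadj i j).contMDiff.contMDiffAt.comp x hG'
    refine ((hinv.mul h1).mdifferentiableAt one_ne_zero).congr_of_eventuallyEq
      (Filter.Eventually.of_forall fun p ↦ ?_)
    simp only [Matrix.inv_def, Matrix.smul_apply, Ring.inverse_eq_inv', smul_eq_mul,
      Matrix.adjugate_apply, Pi.mul_apply]
  have hmul : ∀ j ∈ Finset.univ, MDifferentiableAt I 𝓘(ℝ)
      ((fun p ↦ θ p j) * fun p ↦ (G p)⁻¹ j i) x := by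
    intro j _
    exact (hθ j).mul (hentry j)
  refine (MDifferentiableAt.sum hmul).congr_of_eventuallyEq
    (Filter.Eventually.of_forall fun p ↦ ?_)
  simp only [Matrix.vecMul, dotProduct, Finset.sum_apply, Pi.mul_apply]

/-- The function is the fibre component of the `C^1` tangent map of `h` composed with `Y`. -/
theorem ContMDiffAt.mdifferentiableAt_mvfderiv_apply {x : M} {h : M → ℝ}
    (hh : ContMDiffAt I 𝓘(ℝ) 2 h x) {Y : Π x : M, TangentSpace I x} (hY : MDiffAt (T% Y) x) :
    MDifferentiableAt I 𝓘(ℝ) (fun p ↦ mvfderiv I h p (Y p)) x := by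
  have h1 : MDifferentiableAt I.tangent 𝓘(ℝ).tangent (tangentMap I 𝓘(ℝ) h) (T% Y x) :=
    (ContMDiffAt.contMDiffAt_tangentMap (m := 1) (n := 2) hh (by simp)
      le_rfl).mdifferentiableAt one_ne_zero
  have h2 := h1.comp x hY
  exact ((contMDiff_snd_tangentBundle_modelSpace ℝ 𝓘(ℝ)).contMDiffAt.mdifferentiableAt
    one_ne_zero).comp x h2

variable [RiemannianBundle (fun x : M ↦ TangentSpace I x)]

theorem MDifferentiableAt.inner_vectorField
    [IsContMDiffRiemannianBundle I ∞ E (fun x : M ↦ TangentSpace I x)] {x : M}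
    {V W : Π x : M, TangentSpace I x} (hV : MDiffAt (T% V) x) (hW : MDiffAt (T% W) x) :
    MDifferentiableAt I 𝓘(ℝ) (fun p ↦ (inner ℝ (V p) (W p) : ℝ)) x := by
  have : IsContMDiffRiemannianBundle I 1 E (fun y : M ↦ TangentSpace I y) :=
    .of_le (n := ∞) (mod_cast le_top)
  exact MDifferentiableAt.inner_bundle (E := fun x : M ↦ TangentSpace I x) hV hW

theorem ContMDiffAt.inner_vectorField {n : ℕ∞ω}
    [IsContMDiffRiemannianBundle I n E (fun x : M ↦ TangentSpace I x)] {x : M}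
    {V W : Π x : M, TangentSpace I x} (hV : ContMDiffAt I I.tangent n (T% V) x)
    (hW : ContMDiffAt I I.tangent n (T% W) x) :
    ContMDiffAt I 𝓘(ℝ) n (fun p ↦ (inner ℝ (V p) (W p) : ℝ)) x :=
  ContMDiffAt.inner_bundle (E := fun x : M ↦ TangentSpace I x) hV hW

variable [FiniteDimensional ℝ E]

/-- A vector field is differentiable if its inner products with smooth vector fields are. -/
theorem mdifferentiableAt_of_forall_inner
    [IsContMDiffRiemannianBundle I ∞ E (fun x : M ↦ TangentSpace I x)] {x : M}
    {V : Π x : M, TangentSpace I x}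
    (hV : ∀ W : Π x : M, TangentSpace I x, ContMDiffAt I I.tangent ∞ (T% W) x →
      MDifferentiableAt I 𝓘(ℝ) (fun p ↦ (inner ℝ (V p) (W p) : ℝ)) x) :
    MDiffAt (T% V) x := by
  let e := trivializationAt E (TangentSpace I) x
  have hx : x ∈ e.baseSet := FiberBundle.mem_baseSet_trivializationAt' x
  have he : e.baseSet ∈ 𝓝 x := e.open_baseSet.mem_nhds hx
  let b := Module.finBasis ℝ E
  let s := e.localFrame b
  have hs : IsLocalFrameOn I E ∞ s e.baseSet := e.isLocalFrameOn_localFrame_baseSet I ∞ b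
  have hs1 : IsLocalFrameOn I E 1 s e.baseSet := e.isLocalFrameOn_localFrame_baseSet I 1 b
  have hsm : ∀ i, ContMDiffAt I I.tangent ∞ (T% (s i)) x := hs.contMDiffAt e.open_baseSet hx
  -- The frame coefficients `c` of `V` satisfy `c G = θ`, where `θ` lists the inner products of `V`
  -- with the frame, so `c = θ G⁻¹`.
  let G : M → Matrix (Fin (Module.finrank ℝ E)) (Fin (Module.finrank ℝ E)) ℝ :=
    fun p ↦ Matrix.gram ℝ (fun i ↦ s i p)
  have hdet : ∀ p ∈ e.baseSet, (G p).det ≠ 0 := fun p hp ↦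
    (Matrix.posDef_gram_of_linearIndependent (hs.linearIndependent hp)).det_pos.ne'
  refine hs1.mdifferentiableAt_of_coeff (fun i ↦ ?_) he
  have hG : ∀ i j, ContMDiffAt I 𝓘(ℝ) 1 (fun p ↦ G p i j) x := fun i j ↦
    ((hsm i).inner_vectorField (hsm j)).of_le (mod_cast le_top)
  refine (mdifferentiableAt_vecMul_inv (θ := fun p j ↦ inner ℝ (V p) (s j p)) hG
    (fun j ↦ hV _ (hsm j)) (hdet x hx) i).congr_of_eventuallyEq ?_
  filter_upwards [he] with p hp
  have h1 : (fun j ↦ (inner ℝ (V p) (s j p) : ℝ))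
      = Matrix.vecMul (fun i ↦ hs1.coeff i p (V p)) (G p) := by
    funext j
    conv_lhs => rw [hs1.coeff_sum_eq V hp]
    simp only [sum_inner, real_inner_smul_left, Matrix.vecMul, dotProduct, G, Matrix.gram_apply]
  rw [h1, Matrix.vecMul_vecMul, Matrix.mul_nonsing_inv _ (hdet p hp).isUnit, Matrix.vecMul_one]
  rfl

theorem IsLeviCivita.sub_eq_mlieBracket
    {cov : CovariantDerivative I E (TangentSpace I : M → Type _)} (hcov : IsLeviCivita cov) {x : M}
    {Y Z : Π x : M, TangentSpace I x} (hY : MDiffAt (T% Y) x) (hZ : MDiffAt (T% Z) x) :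
    cov Z x (Y x) - cov Y x (Z x) = VectorField.mlieBracket I Y Z x :=
  cov.torsion_eq_zero_iff.1 hcov.torsion_eq_zero hY hZ

/-- Metricity expands the derivatives and vanishing torsion the brackets; all but two equal terms
cancel. The right side no longer involves the connection, which is what yields regularity. -/
theorem IsLeviCivita.koszul
    {cov : CovariantDerivative I E (TangentSpace I : M → Type _)} (hcov : IsLeviCivita cov) {x : M}
    {Y Z W : Π x : M, TangentSpace I x} (hY : MDiffAt (T% Y) x) (hZ : MDiffAt (T% Z) x)
    (hW : MDiffAt (T% W) x) :
    inner ℝ (cov Z x (Y x)) (W x)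
      = (mvfderiv I (fun p ↦ (inner ℝ (Z p) (W p) : ℝ)) x (Y x)
        + mvfderiv I (fun p ↦ (inner ℝ (Y p) (W p) : ℝ)) x (Z x)
        - mvfderiv I (fun p ↦ (inner ℝ (Y p) (Z p) : ℝ)) x (W x)
        + inner ℝ (VectorField.mlieBracket I Y Z x) (W x)
        - inner ℝ (VectorField.mlieBracket I Y W x) (Z x)
        - inner ℝ (VectorField.mlieBracket I Z W x) (Y x)) * (1 / 2) := by
  rw [hcov.metric x Z W hZ hW, hcov.metric x Y W hY hW, hcov.metric x Y Z hY hZ,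
    ← hcov.sub_eq_mlieBracket hY hZ, ← hcov.sub_eq_mlieBracket hY hW,
    ← hcov.sub_eq_mlieBracket hZ hW]
  simp only [inner_sub_left]
  rw [real_inner_comm _ (Z x), real_inner_comm _ (Y x), real_inner_comm _ (Y x)]
  ring

/-- The Levi-Civita connection maps smooth vector fields to differentiable ones. -/
theorem IsLeviCivita.mdifferentiableAt
    [IsContMDiffRiemannianBundle I ∞ E (fun x : M ↦ TangentSpace I x)]
    {cov : CovariantDerivative I E (TangentSpace I : M → Type _)} (hcov : IsLeviCivita cov) {x : M}
    {Y Z : Π x : M, TangentSpace I x} (hY : ContMDiffAt I I.tangent ∞ (T% Y) x)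
    (hZ : ContMDiffAt I I.tangent ∞ (T% Z) x) :
    MDiffAt (T% (fun p ↦ cov Z p (Y p))) x := by
  have hev : ∀ {X : Π x : M, TangentSpace I x}, ContMDiffAt I I.tangent ∞ (T% X) x →
      ∀ᶠ p in 𝓝 x, MDiffAt (T% X) p := by
    intro X hX
    filter_upwards [(contMDiffAt_iff_contMDiffAt_nhds (n := 1) (by simp)).1
      (hX.of_le (mod_cast le_top))] with p hp using hp.mdifferentiableAt one_ne_zero
  have hbr : ∀ {X Y : Π x : M, TangentSpace I x}, ContMDiffAt I I.tangent ∞ (T% X) x →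
      ContMDiffAt I I.tangent ∞ (T% Y) x → MDiffAt (T% (VectorField.mlieBracket I X Y)) x := by
    intro X Y hX hY
    have : IsManifold I (minSmoothness ℝ 2) M := by
      simpa using IsManifold.of_le (n := ∞) (m := 2) ENat.LEInfty.out
    have : IsManifold I (((2 : ℕ∞) : ℕ∞ω) + 1) M := .of_le (n := ∞) (mod_cast le_top)
    exact (ContMDiffAt.mlieBracket_vectorField (m := 1) (n := 2) (hX.of_le (mod_cast le_top))
      (hY.of_le (mod_cast le_top)) (by simp; rfl)).mdifferentiableAt one_ne_zero
  have hin : ∀ {X Y W : Π x : M, TangentSpace I x}, ContMDiffAt I I.tangent ∞ (T% X) x →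
      ContMDiffAt I I.tangent ∞ (T% Y) x → ContMDiffAt I I.tangent ∞ (T% W) x →
      MDifferentiableAt I 𝓘(ℝ)
        (fun p ↦ mvfderiv I (fun p ↦ (inner ℝ (X p) (Y p) : ℝ)) p (W p)) x := by
    intro X Y W hX hY hW
    exact ContMDiffAt.mdifferentiableAt_mvfderiv_apply
      ((hX.inner_vectorField hY).of_le (n := ∞) ENat.LEInfty.out)
      (hW.mdifferentiableAt (by simp))
  have hd : ∀ {X : Π x : M, TangentSpace I x}, ContMDiffAt I I.tangent ∞ (T% X) x →
      MDiffAt (T% X) x := fun hX ↦ hX.mdifferentiableAt (by simp)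
  refine mdifferentiableAt_of_forall_inner fun W hW ↦ ?_
  have key := (((((hin hZ hW hY).add (hin hY hW hZ)).sub (hin hY hZ hW)).add
    ((hbr hY hZ).inner_vectorField (hd hW))).sub
    ((hbr hY hW).inner_vectorField (hd hZ))).sub ((hbr hZ hW).inner_vectorField (hd hY))
  refine (key.mul (mdifferentiableAt_const (c := (1 / 2 : ℝ)))).congr_of_eventuallyEq ?_
  filter_upwards [hev hY, hev hZ, hev hW] with p h1 h2 h3
  exact hcov.koszul h1 h2 h3

end LeviCivita

/-! ### Curvature of the semisymmetric connection of a parallel field -/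

section Semisymmetric

variable {E : Type*} [NormedAddCommGroup E] [NormedSpace ℝ E] [FiniteDimensional ℝ E]
  {H : Type*} [TopologicalSpace H] {I : ModelWithCorners ℝ E H}
  {M : Type*} [TopologicalSpace M] [ChartedSpace H M] [IsManifold I ∞ M]
  [RiemannianBundle (fun x : M ↦ TangentSpace I x)]
  [IsContMDiffRiemannianBundle I ∞ E (fun x : M ↦ TangentSpace I x)]
  {cov cov' : CovariantDerivative I E (TangentSpace I : M → Type _)}
  {ζ : Π x : M, TangentSpace I x}

/-- The second covariant derivative with respect to the semisymmetric metric connection of a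
parallel vector field. -/
theorem IsLeviCivita.semisymmetric_cov_cov (hcov : IsLeviCivita cov)
    (hζ : ∀ x, MDiffAt (T% ζ) x) (hpar : ∀ x (u : TangentSpace I x), cov ζ x u = 0)
    (h : ∀ (x : M) (Y : Π x : M, TangentSpace I x), MDiffAt (T% Y) x → ∀ u : TangentSpace I x,
      cov' Y x u = cov Y x u + (inner ℝ (Y x) (ζ x) • u - inner ℝ u (Y x) • ζ x))
    {x : M} {Y Z : Π x : M, TangentSpace I x} (hY : ContMDiffAt I I.tangent ∞ (T% Y) x)
    (hZ : ContMDiffAt I I.tangent ∞ (T% Z) x) (u : TangentSpace I x) :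
    cov' (fun p ↦ cov' Z p (Y p)) x u = cov (fun p ↦ cov Z p (Y p)) x u
      + (inner ℝ (Z x) (ζ x) • cov Y x u + inner ℝ (cov Z x u) (ζ x) • Y x
      - (inner ℝ (cov Y x u) (Z x) + inner ℝ (cov Z x u) (Y x)) • ζ x
      + inner ℝ (cov Z x (Y x)) (ζ x) • u + (inner ℝ (Z x) (ζ x) * inner ℝ (Y x) (ζ x)) • u
      - (inner ℝ (Y x) (Z x) * inner ℝ (ζ x) (ζ x)) • u - inner ℝ u (cov Z x (Y x)) • ζ x
      - (inner ℝ (Z x) (ζ x) * inner ℝ u (Y x)) • ζ x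
      + (inner ℝ (Y x) (Z x) * inner ℝ u (ζ x)) • ζ x) := by
  have hY1 : MDiffAt (T% Y) x := hY.mdifferentiableAt (by simp)
  have hZ1 : MDiffAt (T% Z) x := hZ.mdifferentiableAt (by simp)
  have hC := cov.isCovariantDerivativeOnUniv
  have hC' := cov'.isCovariantDerivativeOnUniv
  let a : M → ℝ := fun p ↦ inner ℝ (Z p) (ζ p)
  let c : M → ℝ := fun p ↦ -inner ℝ (Y p) (Z p)
  have ha : MDifferentiableAt I 𝓘(ℝ) a x := hZ1.inner_vectorField (hζ x)
  have hc : MDifferentiableAt I 𝓘(ℝ) c x := (hY1.inner_vectorField hZ1).neg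
  let A : Π x : M, TangentSpace I x := fun p ↦ cov Z p (Y p)
  have hA : MDiffAt (T% A) x := hcov.mdifferentiableAt hY hZ
  -- `W` is `∇'_Y Z` written out near `x`. Applying the difference formula and the Leibniz rule to
  -- it, every term containing `∇ζ` vanishes.
  let W : Π x : M, TangentSpace I x := A + (a • Y + c • ζ)
  have haY : MDiffAt (T% (a • Y)) x := ha.smul_section hY1
  have hcζ : MDiffAt (T% (c • ζ)) x := hc.smul_section (hζ x)
  have hs : MDiffAt (T% (a • Y + c • ζ)) x := mdifferentiableAt_add_section haY hcζ
  have hW : MDiffAt (T% W) x := mdifferentiableAt_add_section hA hs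
  have hev : ∀ᶠ p in 𝓝 x, cov' Z p (Y p) = W p := by
    filter_upwards [(contMDiffAt_iff_contMDiffAt_nhds (n := 1) (by simp)).1
      (hZ.of_le (mod_cast le_top))] with p hp
    rw [h p Z (hp.mdifferentiableAt one_ne_zero)]
    simp only [W, A, a, c, Pi.add_apply, Pi.smul_apply', neg_smul, sub_eq_add_neg]
  have hW' : MDiffAt (T% (fun p ↦ cov' Z p (Y p))) x :=
    hW.congr_of_eventuallyEq (hev.mono fun p hp ↦ congrArg (TotalSpace.mk p) hp)
  rw [show cov' (fun p ↦ cov' Z p (Y p)) x = cov' W x from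
    hC'.congr_of_eventuallyEq hW' hW Filter.univ_mem hev, h x W hW]
  have e1 : cov W x = cov A x + (a x • cov Y x + (mvfderiv I a x).smulRight (Y x)
      + (c x • cov ζ x + (mvfderiv I c x).smulRight (ζ x))) := by
    rw [hC.add hA hs, hC.add haY hcζ, hC.leibniz hY1 ha, hC.leibniz (hζ x) hc]
  have e2 : mvfderiv I a x u = inner ℝ (cov Z x u) (ζ x) := by
    rw [hcov.metric x Z ζ hZ1 (hζ x), hpar, inner_zero_right, add_zero]
  have e3 : mvfderiv I c x u = -(inner ℝ (cov Y x u) (Z x) + inner ℝ (cov Z x u) (Y x)) := by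
    have : mvfderiv I c x = -mvfderiv I (fun p ↦ (inner ℝ (Y p) (Z p) : ℝ)) x := mvfderiv_neg
    rw [this, real_inner_comm _ (cov Z x u), ← hcov.metric x Y Z hY1 hZ1]
    rfl
  have e4 : cov W x u = cov A x u + (a x • cov Y x u + inner ℝ (cov Z x u) (ζ x) • Y x
      - (inner ℝ (cov Y x u) (Z x) + inner ℝ (cov Z x u) (Y x)) • ζ x) := by
    rw [e1]
    simp only [add_apply, smul_apply,
      ContinuousLinearMap.smulRight_apply, hpar, e2, e3]
    module
  have e5 : W x = A x + (a x • Y x + c x • ζ x) := rfl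
  rw [e4, e5]
  simp only [inner_add_left, inner_add_right, real_inner_smul_left, real_inner_smul_right, A, a, c]
  module

/-- The curvature of the semisymmetric metric connection of a parallel vector field. -/
theorem IsLeviCivita.semisymmetric_curvature (hcov : IsLeviCivita cov)
    (hζ : ∀ x, MDiffAt (T% ζ) x) (hpar : ∀ x (u : TangentSpace I x), cov ζ x u = 0)
    (h : ∀ (x : M) (Y : Π x : M, TangentSpace I x), MDiffAt (T% Y) x → ∀ u : TangentSpace I x,
      cov' Y x u = cov Y x u + (inner ℝ (Y x) (ζ x) • u - inner ℝ u (Y x) • ζ x))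
    {x : M} {X Y Z : Π x : M, TangentSpace I x} (hX : ContMDiffAt I I.tangent ∞ (T% X) x)
    (hY : ContMDiffAt I I.tangent ∞ (T% Y) x) (hZ : ContMDiffAt I I.tangent ∞ (T% Z) x) :
    curvature cov' X Y Z x = curvature cov X Y Z x
      + ((inner ℝ (Z x) (ζ x) * inner ℝ (Y x) (ζ x)
          - inner ℝ (Y x) (Z x) * inner ℝ (ζ x) (ζ x)) • X x
        - (inner ℝ (X x) (ζ x) * inner ℝ (Z x) (ζ x)) • Y x
        + (inner ℝ (X x) (Z x) * inner ℝ (ζ x) (ζ x)) • Y x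
        + (inner ℝ (X x) (ζ x) * inner ℝ (Y x) (Z x)) • ζ x
        - (inner ℝ (X x) (Z x) * inner ℝ (Y x) (ζ x)) • ζ x) := by
  have hX1 : MDiffAt (T% X) x := hX.mdifferentiableAt (by simp)
  have hY1 : MDiffAt (T% Y) x := hY.mdifferentiableAt (by simp)
  have hZ1 : MDiffAt (T% Z) x := hZ.mdifferentiableAt (by simp)
  simp only [curvature]
  rw [hcov.semisymmetric_cov_cov hζ hpar h hY hZ, hcov.semisymmetric_cov_cov hζ hpar h hX hZ,
    h x Z hZ1, ← hcov.sub_eq_mlieBracket hX1 hY1]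
  -- In the correction, the terms with covariant derivatives of `X`, `Y`, `Z` are either symmetric
  -- in `X`, `Y` or cancel against the bracket term.
  simp only [inner_sub_left, real_inner_comm (X x) (Y x), real_inner_comm (cov Z x (Y x)) (X x),
    real_inner_comm (cov Z x (X x)) (Y x)]
  module

/-- The multiple of the identity in the curvature correction contributes the dimension to the trace;
the four rank-one terms together contribute the `-2`. -/
theorem IsLeviCivita.semisymmetric_ricci (hcov : IsLeviCivita cov)
    (hζ : ∀ x, MDiffAt (T% ζ) x) (hpar : ∀ x (u : TangentSpace I x), cov ζ x u = 0)
    (h : ∀ (x : M) (Y : Π x : M, TangentSpace I x), MDiffAt (T% Y) x → ∀ u : TangentSpace I x,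
      cov' Y x u = cov Y x u + (inner ℝ (Y x) (ζ x) • u - inner ℝ u (Y x) • ζ x))
    (x : M) (v w : TangentSpace I x) :
    ricci cov' x v w = ricci cov x v w + ((Module.finrank ℝ E : ℝ) - 2)
      * (inner ℝ v (ζ x) * inner ℝ w (ζ x) - inner ℝ v w * inner ℝ (ζ x) (ζ x)) := by
  have hext := fun v : TangentSpace I x ↦
    FiberBundle.contMDiffAt_extend (k := ∞) I E v
  let b : Module.Basis (Fin (Module.finrank ℝ E)) ℝ (TangentSpace I x) := Module.finBasis ℝ E
  -- This is the trace of the rank-one map `u ↦ φ(u) a`, in a basis that need not be orthonormal.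
  have htr : ∀ (φ : TangentSpace I x →ₗ[ℝ] ℝ) (a : TangentSpace I x),
      ∑ i, φ (b i) * b.coord i a = φ a := by
    intro φ a
    conv_rhs => rw [← b.sum_repr a, map_sum]
    refine Finset.sum_congr rfl fun i _ ↦ ?_
    rw [map_smul, smul_eq_mul, mul_comm, Module.Basis.coord_apply]
  have hid : ∑ i, b.coord i (b i) = (Module.finrank ℝ E : ℝ) := by
    simp [Module.Basis.coord_apply]
  have hin : ∀ a a' : TangentSpace I x, ∑ i, inner ℝ (b i) a * b.coord i a' = inner ℝ a' a :=
    fun a a' ↦ htr ((innerₗ (TangentSpace I x)).flip a) a'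
  have hcurv : ∀ u : TangentSpace I x, curvatureAt cov' x u v w = curvatureAt cov x u v w
      + ((inner ℝ w (ζ x) * inner ℝ v (ζ x) - inner ℝ v w * inner ℝ (ζ x) (ζ x)) • u
        - (inner ℝ u (ζ x) * inner ℝ w (ζ x)) • v + (inner ℝ u w * inner ℝ (ζ x) (ζ x)) • v
        + (inner ℝ u (ζ x) * inner ℝ v w) • ζ x - (inner ℝ u w * inner ℝ v (ζ x)) • ζ x) := by
    intro u
    have := hcov.semisymmetric_curvature hζ hpar h (hext u) (hext v) (hext w)
    simp only [FiberBundle.extend_apply_self] at this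
    exact this
  have key : ∀ i, b.coord i (curvatureAt cov' x (b i) v w)
      = b.coord i (curvatureAt cov x (b i) v w)
      + ((inner ℝ w (ζ x) * inner ℝ v (ζ x) - inner ℝ v w * inner ℝ (ζ x) (ζ x)) * b.coord i (b i)
        - inner ℝ w (ζ x) * (inner ℝ (b i) (ζ x) * b.coord i v)
        + inner ℝ (ζ x) (ζ x) * (inner ℝ (b i) w * b.coord i v)
        + inner ℝ v w * (inner ℝ (b i) (ζ x) * b.coord i (ζ x))
        - inner ℝ v (ζ x) * (inner ℝ (b i) w * b.coord i (ζ x))) := by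
    intro i
    rw [hcurv]
    simp only [map_add, map_sub, map_smul, smul_eq_mul]
    ring
  have h1 : ricci cov' x v w = ∑ i, b.coord i (curvatureAt cov' x (b i) v w) := rfl
  have h2 : ricci cov x v w = ∑ i, b.coord i (curvatureAt cov x (b i) v w) := rfl
  rw [h1, h2, Finset.sum_congr rfl fun i _ ↦ key i]
  simp only [Finset.sum_add_distrib, Finset.sum_sub_distrib, ← Finset.mul_sum, hid, hin]
  rw [real_inner_comm w (ζ x)]
  ring

end Semisymmetric

/-! ### Smoothness of `η ⊗ η` and `g - η ⊗ η` -/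

section Tensors

variable {E : Type*} [NormedAddCommGroup E] [NormedSpace ℝ E]
  {H : Type*} [TopologicalSpace H] {I : ModelWithCorners ℝ E H}
  {M : Type*} [TopologicalSpace M] [ChartedSpace H M] [IsManifold I ∞ M]

/-- In a trivialization the coordinate of `η ⊗ η` is a quadratic, hence smooth, function of that of
`η`. -/
theorem contMDiff_smulRight_self {η : Π x : M, TangentSpace I x →L[ℝ] ℝ}
    (hη : ContMDiff I (I.prod 𝓘(ℝ, E →L[ℝ] ℝ)) ∞
      (fun x ↦ TotalSpace.mk' (E →L[ℝ] ℝ) (E := fun x ↦ TangentSpace I x →L[ℝ] ℝ) x (η x))) :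
    ContMDiff I (I.prod 𝓘(ℝ, E →L[ℝ] E →L[ℝ] ℝ)) ∞
      (fun x ↦ TotalSpace.mk' (E →L[ℝ] E →L[ℝ] ℝ)
        (E := fun x ↦ TangentSpace I x →L[ℝ] TangentSpace I x →L[ℝ] ℝ) x
        ((η x).smulRight (η x))) := by
  intro x₀
  have h := hη x₀
  rw [contMDiffAt_section] at h ⊢
  have h1 : ContDiff ℝ ∞ fun p : (E →L[ℝ] ℝ) × (E →L[ℝ] ℝ) ↦ p.1.smulRight p.2 :=
    isBoundedBilinearMap_smulRight.contDiff
  have h2 : ContDiff ℝ ∞ fun a : E →L[ℝ] ℝ ↦ a.smulRight a :=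
    h1.comp (contDiff_id.prodMk contDiff_id)
  refine (h2.contMDiff.contMDiffAt.comp x₀ h).congr_of_eventuallyEq ?_
  filter_upwards [(trivializationAt E (TangentSpace I) x₀).open_baseSet.mem_nhds
    (FiberBundle.mem_baseSet_trivializationAt' x₀)] with x hx
  ext v w
  simp only [hom_trivializationAt_apply, Function.comp_apply]
  rw [inCoordinates_apply_eq₂ hx hx (Set.mem_univ _),
    ContinuousLinearMap.inCoordinates_eq hx (Set.mem_univ _)]
  simp

variable [RiemannianBundle (fun x : M ↦ TangentSpace I x)]
  [IsContMDiffRiemannianBundle I ∞ E (fun x : M ↦ TangentSpace I x)]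

theorem contMDiff_of_apply_eq_inner {ζ : Π x : M, TangentSpace I x}
    (hζ : ContMDiff I I.tangent ∞ (T% ζ))
    {η : Π x : M, TangentSpace I x →L[ℝ] ℝ} (hη : ∀ x v, η x v = inner ℝ v (ζ x)) :
    ContMDiff I (I.prod 𝓘(ℝ, E →L[ℝ] ℝ)) ∞
      (fun x ↦ TotalSpace.mk' (E →L[ℝ] ℝ) (E := fun x ↦ TangentSpace I x →L[ℝ] ℝ) x (η x)) := by
  obtain ⟨g, hg, hgi⟩ := IsContMDiffRiemannianBundle.exists_contMDiff (IB := I) (n := ∞) (F := E)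
    (E := fun x : M ↦ TangentSpace I x)
  have : η = fun x ↦ g x (ζ x) := by
    funext x
    ext v
    rw [hη, real_inner_comm, hgi]
  rw [this]
  exact ContMDiff.clm_bundle_apply (E₁ := fun x : M ↦ TangentSpace I x)
    (E₂ := fun x : M ↦ TangentSpace I x →L[ℝ] ℝ) hg hζ

theorem exists_contMDiff_inner_sub_mul {ζ : Π x : M, TangentSpace I x}
    (hζ : ContMDiff I I.tangent ∞ (T% ζ))
    {η : Π x : M, TangentSpace I x →L[ℝ] ℝ} (hη : ∀ x v, η x v = inner ℝ v (ζ x)) :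
    ∃ D : Π x : M, TangentSpace I x →L[ℝ] TangentSpace I x →L[ℝ] ℝ,
      ContMDiff I (I.prod 𝓘(ℝ, E →L[ℝ] E →L[ℝ] ℝ)) ∞
        (fun x ↦ TotalSpace.mk' (E →L[ℝ] E →L[ℝ] ℝ)
          (E := fun x ↦ TangentSpace I x →L[ℝ] TangentSpace I x →L[ℝ] ℝ) x (D x)) ∧
      ∀ x v w, D x v w = inner ℝ v w - η x v * η x w := by
  obtain ⟨g, hg, hgi⟩ := IsContMDiffRiemannianBundle.exists_contMDiff (IB := I) (n := ∞) (F := E)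
    (E := fun x : M ↦ TangentSpace I x)
  refine ⟨fun x ↦ g x - (η x).smulRight (η x),
    ContMDiff.sub_section hg (contMDiff_smulRight_self (contMDiff_of_apply_eq_inner hζ hη)),
    fun x v w ↦ ?_⟩
  rw [hgi]
  rfl

end Tensors

/-! ### The theorem on Ricci solitons -/

theorem theorem5p2 (m n : ℕ) (hmn : m < n)
    -- the ambient SQ-Sasakian manifold
    {N : Type*} [TopologicalSpace N] [T2Space N]
    [ChartedSpace (EuclideanSpace ℝ (Fin (2 * n + 1))) N] [IsManifold (𝓡 (2 * n + 1)) ∞ N]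
    [RiemannianBundle (fun y : N ↦ TangentSpace (𝓡 (2 * n + 1)) y)]
    [IsContMDiffRiemannianBundle (𝓡 (2 * n + 1)) ∞ (EuclideanSpace ℝ (Fin (2 * n + 1)))
      (fun y : N ↦ TangentSpace (𝓡 (2 * n + 1)) y)]
    (A : AlmostContactMetric (𝓡 (2 * n + 1)) N)
    (covN : CovariantDerivative (𝓡 (2 * n + 1)) (EuclideanSpace ℝ (Fin (2 * n + 1)))
      (TangentSpace (𝓡 (2 * n + 1)) : N → Type _))
    (hcovN : IsLeviCivita covN) (β : N → ℝ) (hA : A.IsSQSasakian covN β)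
    -- its semisymmetric metric connection
    (covN' : CovariantDerivative (𝓡 (2 * n + 1)) (EuclideanSpace ℝ (Fin (2 * n + 1)))
      (TangentSpace (𝓡 (2 * n + 1)) : N → Type _))
    (hcovN' : IsSemisymmetricMetric A.η covN')
    -- the submanifold
    {M : Type*} [TopologicalSpace M] [T2Space M] [Nonempty M]
    [ChartedSpace (EuclideanSpace ℝ (Fin (2 * m + 1))) M] [IsManifold (𝓡 (2 * m + 1)) ∞ M]
    [RiemannianBundle (fun x : M ↦ TangentSpace (𝓡 (2 * m + 1)) x)]
    [IsContMDiffRiemannianBundle (𝓡 (2 * m + 1)) ∞ (EuclideanSpace ℝ (Fin (2 * m + 1)))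
      (fun x : M ↦ TangentSpace (𝓡 (2 * m + 1)) x)]
    (f : M → N) (hf : IsRiemannianSubmanifold (𝓡 (2 * m + 1)) (𝓡 (2 * n + 1)) f)
    (hanti : A.IsAntiInvariant (𝓡 (2 * m + 1)) f)
    (ξM : Π x : M, TangentSpace (𝓡 (2 * m + 1)) x)
    (hξM : A.IsTangentStructureField (𝓡 (2 * m + 1)) f ξM)
    -- the Levi-Civita connection of the submanifold
    (covM : CovariantDerivative (𝓡 (2 * m + 1)) (EuclideanSpace ℝ (Fin (2 * m + 1)))
      (TangentSpace (𝓡 (2 * m + 1)) : M → Type _))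
    (hcovM : IsLeviCivita covM)
    -- the connection of the submanifold induced by the semisymmetric metric connection
    (covM' : CovariantDerivative (𝓡 (2 * m + 1)) (EuclideanSpace ℝ (Fin (2 * m + 1)))
      (TangentSpace (𝓡 (2 * m + 1)) : M → Type _))
    (hcovM' : IsInducedConnection f covN' covM')
    (lam : ℝ) (hsol : IsRicciSolitonWrt covM' ξM lam) :
    (∀ (x : M) (y z : TangentSpace (𝓡 (2 * m + 1)) x),
      ricci covM x y z
        = (2 * (m : ℝ) - 2 - lam) * inner ℝ y z
          - (2 * (m : ℝ) - 2) *
            (A.restrictη (𝓡 (2 * m + 1)) f x y * A.restrictη (𝓡 (2 * m + 1)) f x z)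
          + (2 * (m : ℝ) - 1) * A.restrictΦ (𝓡 (2 * m + 1)) f x y z) ∧
    (2 ≤ m →
      IsPseudoEtaEinstein (ricci covM) ξM (A.restrictη (𝓡 (2 * m + 1)) f)) := by
  have hη : ∀ x (v : TangentSpace (𝓡 (2 * m + 1)) x),
      A.restrictη (𝓡 (2 * m + 1)) f x v = inner ℝ v (ξM x) := by
    intro x v
    have h := hf.inner_mfderiv x v (ξM x)
    rw [hξM x, A.inner_ξ] at h
    exact h
  have hnorm : ∀ x, inner ℝ (ξM x) (ξM x) = (1 : ℝ) := by
    intro x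
    have h := hf.inner_mfderiv x (ξM x) (ξM x)
    rw [hξM x, A.inner_ξ, A.η_ξ] at h
    exact h.symm
  -- Anti-invariance kills `Φ` on `M`, so its coefficient in the Ricci formula is immaterial.
  have hΦ : ∀ x (y z : TangentSpace (𝓡 (2 * m + 1)) x),
      A.restrictΦ (𝓡 (2 * m + 1)) f x y z = 0 := by
    intro x y z
    have h := hanti x z y
    rw [real_inner_comm] at h
    exact h
  have hξ : ContMDiff (𝓡 (2 * m + 1)) (𝓡 (2 * m + 1)).tangent ∞ (T% ξM) := fun x ↦
    (hf.isImmersion.isImmersionAt x).contMDiffAt_of_related (A.contMDiff_ξ (f x))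
      (Filter.Eventually.of_forall fun p ↦ (hξM p).symm)
  have hξd : ∀ x, MDifferentiableAt (𝓡 (2 * m + 1)) (𝓡 (2 * m + 1)).tangent (T% ξM) x := fun x ↦ (hξ x).mdifferentiableAt (by simp)
  have hξN : ∀ y, MDifferentiableAt (𝓡 (2 * n + 1)) (𝓡 (2 * n + 1)).tangent (T% A.ξ) y := fun y ↦ (A.contMDiff_ξ y).mdifferentiableAt (by simp)
  have hN : ∀ y (v : TangentSpace (𝓡 (2 * n + 1)) y),
      covN' A.ξ y v = -(β y • A.φ y v) + (v - inner ℝ v (A.ξ y) • A.ξ y) := by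
    intro y v
    have h := IsMetricConnection.apply_eq_add_of_torsion hcovN.metric hcovN'.metric (A.ξ y)
      (fun u v ↦ by
        rw [hcovN'.torsion_eq, hcovN.torsion_eq_zero, A.inner_ξ, A.inner_ξ]
        exact (zero_add _).symm) (hξN y) v
    rw [h, hA.cov_ξ, A.inner_ξ y (A.ξ y), A.η_ξ, one_smul]
  have hmet : IsMetricConnection covM' := IsMetricConnection.of_induced hf hcovN'.metric hcovM'
  have htor : ∀ x (u v : TangentSpace (𝓡 (2 * m + 1)) x),
      covM'.torsion x u v = inner ℝ v (ξM x) • u - inner ℝ u (ξM x) • v := by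
    intro x u v
    refine ext_inner_right ℝ fun w ↦ ?_
    rw [IsInducedConnection.inner_torsion hf hcovM', hcovN'.torsion_eq, inner_sub_left,
      inner_sub_left, inner_smul_left, inner_smul_left, inner_smul_left, inner_smul_left,
      hf.inner_mfderiv, hf.inner_mfderiv, ← hη, ← hη]
    rfl
  have hdiff : ∀ x (Y : Π x : M, TangentSpace (𝓡 (2 * m + 1)) x),
      MDifferentiableAt (𝓡 (2 * m + 1)) (𝓡 (2 * m + 1)).tangent (T% Y) x → ∀ u,
      covM' Y x u = covM Y x u + (inner ℝ (Y x) (ξM x) • u - inner ℝ u (Y x) • ξM x) := by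
    intro x Y hY u
    refine IsMetricConnection.apply_eq_add_of_torsion hcovM.metric hmet (ξM x)
      (fun u v ↦ ?_) hY u
    rw [htor, hcovM.torsion_eq_zero]
    exact (zero_add _).symm
  have hcov'ξ : ∀ x (u : TangentSpace (𝓡 (2 * m + 1)) x),
      covM' ξM x u = u - inner ℝ u (ξM x) • ξM x := by
    intro x u
    refine ext_inner_right ℝ fun w ↦ ?_
    rw [hcovM' x ξM A.ξ (hξd x) (hξN (f x)) (Filter.Eventually.of_forall fun p ↦ (hξM p).symm),
      hN, inner_add_left, inner_neg_left, inner_smul_left, hanti, inner_sub_left, inner_sub_left,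
      inner_smul_left, inner_smul_left, ← hξM x, hf.inner_mfderiv, hf.inner_mfderiv,
      hf.inner_mfderiv]
    simp
  -- The whole of `∇'_u ξ` equals the semisymmetric correction at `Y = ξ`, leaving nothing for the
  -- Levi-Civita part.
  have hpar : ∀ x u, covM ξM x u = 0 := by
    intro x u
    have h := hdiff x ξM (hξd x) u
    rw [hcov'ξ, hnorm, one_smul] at h
    exact right_eq_add.1 h
  have hS : ∀ (x : M) (y z : TangentSpace (𝓡 (2 * m + 1)) x),
      ricci covM x y z = (2 * (m : ℝ) - 2 - lam) * inner ℝ y z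
        - (2 * (m : ℝ) - 2) * (inner ℝ y (ξM x) * inner ℝ z (ξM x)) := by
    intro x y z
    have h1 := hsol x y z
    rw [IsLeviCivita.semisymmetric_ricci hcovM hξd hpar hdiff, hnorm, finrank_euclideanSpace,
      Fintype.card_fin, hcov'ξ, hcov'ξ, inner_sub_left, inner_sub_right, inner_smul_left,
      inner_smul_right, real_inner_comm z (ξM x)] at h1
    push_cast at h1
    simp only [conj_trivial] at h1
    linarith
  refine ⟨fun x y z ↦ ?_, fun hm ↦ ⟨?_, ?_⟩⟩
  · rw [hS, hΦ, hη, hη]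
    ring
  · obtain ⟨x⟩ := ‹Nonempty M›
    by_contra! h
    -- The formula gives `S(ξ, ξ) = -λ`, so `S = 0` forces `λ = 0`. A nonzero `y` in the kernel of
    -- `η` then has `S(y, y) = (2m - 2)|y|² ≠ 0`.
    have hl := hS x (ξM x) (ξM x)
    rw [h, hnorm] at hl
    have : FiniteDimensional ℝ (TangentSpace (𝓡 (2 * m + 1)) x) :=
      inferInstanceAs (FiniteDimensional ℝ (EuclideanSpace ℝ (Fin (2 * m + 1))))
    have hker : (LinearMap.ker (A.restrictη (𝓡 (2 * m + 1)) f x).toLinearMap) ≠ ⊥ := by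
      refine LinearMap.ker_ne_bot_of_finrank_lt ?_
      change Module.finrank ℝ ℝ < Module.finrank ℝ (EuclideanSpace ℝ (Fin (2 * m + 1)))
      rw [finrank_euclideanSpace, Fintype.card_fin, Module.finrank_self]
      omega
    obtain ⟨y, hy, hy0⟩ := (Submodule.ne_bot_iff _).1 hker
    have hy' : inner ℝ y (ξM x) = (0 : ℝ) :=
      (hη x y).symm.trans hy
    have hyS := hS x y y
    rw [h, hy'] at hyS
    have hyy : (inner ℝ y y : ℝ) ≠ 0 :=
      fun h0 ↦ hy0 ((inner_self_eq_zero (𝕜 := ℝ) (E := TangentSpace (𝓡 (2 * m + 1)) x)).1 h0)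
    have hm' : (2 : ℝ) ≤ m := by exact_mod_cast hm
    have hlam : lam = 0 := by linarith
    subst hlam
    exact mul_ne_zero (by linarith : (2 * (m : ℝ) - 2 - 0) ≠ 0) hyy (by linarith)
  · have hm' : (2 : ℝ) ≤ m := by exact_mod_cast hm
    obtain ⟨D, hD, hDa⟩ := exists_contMDiff_inner_sub_mul hξ hη
    -- `Φ` being zero on `M`, the choice is `D = g - η ⊗ η` with `s = 1`; this shifts the
    -- coefficients of `g` and `η ⊗ η` by `-1` and `+1`. The bound `m ≥ 2` gives `q < 0`.
    refine ⟨fun _ ↦ 2 * m - 3 - lam, fun _ ↦ 3 - 2 * m, fun _ ↦ 1, D, contMDiff_const,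
      contMDiff_const, contMDiff_const, hD, fun _ ↦ by linarith, fun _ ↦ one_ne_zero,
      fun x y ↦ ?_, fun x y z ↦ ?_⟩
    · rw [hDa, hη, hη, hnorm]
      ring
    · rw [hDa, hη, hη, hS]
      ring
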